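/- Let $k=\mathbb{Q}(\beta)$. Let $\phi_n$ ($n\in\mathbb{Z}$) be the neutral fermions, with $\phi_m\phi_n+\phi_n\phi_m=2(-1)^m\delta_{m+n,0}$, acting on the Fock space $\mathcal F$ with vacuum $|0\rangle$, $\phi_{-n}|0\rangle=0$ for $n>0$, and basis $\phi_{n_1}\cdots\phi_{n_s}|0\rangle$ ($s\ge 0$, $n_1>\dots>n_s\ge 0$). Let $v\mapsto\langle 0|v\rangle$ be the linear functional that is $1$ on $|0\rangle$ and $0$ on the other basis vectors. For odd $m$ put $b_m=\frac14\sum_{i\in\mathbb{Z}}(-1)^i\phi_{-i-m}\phi_i$. Let $*$ be the anti-involution with $(\phi_n)^*=(-1)^n\phi_{-n}$, so that $(b_m)^*=b_{-m}$. Let $\phi^{(\beta)}_n=\sum_{m\ge n}\binom{m}{m-n}\left(\frac{\beta}{2}\right)^{m-n}\phi_m$ and $\phi^{[\beta]}_n=(-1)^n(\phi^{(-\beta)}_{-n})^*$. For $m>0$ let $b^{(\beta)}_{-m}$ be obtained from the expansion of $\frac12\{(X-\frac{\beta}{2})^{-m}-(-X-\frac{\beta}{2})^{-m}\}$ in powers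 of $X^{-1}$ by $X^{-n}\mapsto b_{-n}$, and let $b^{[\beta]}_m=(b^{(\beta)}_{-m})^*$. Put $$\theta=2\sum_{n=1,3,5,\dots}\left(\frac{\beta}{2}\right)^n\frac{b_n}{n},\qquad \mathcal H^{[\beta]}(x)=2\sum_{n\ge1}\frac{p_n(x)}{n}\,b^{[\beta]}_n,$$ where $p_n(x)=x_1^n+x_2^n+\cdots$. On each vector of $\mathcal F$ all these sums, and the exponentials below, are finite. For integers $n_1,\dots,n_s$ (possibly negative or not decreasing) define the symmetric function $$o_{(n_1,\dots,n_s)}(x)=2^{-s}\,\langle 0|e^{\mathcal H^{[\beta]}(x)}e^{-\theta}\phi^{[\beta]}_{n_1}e^{-\theta}\phi^{[\beta]}_{n_2}\cdots e^{-\theta}\phi^{[\beta]}_{n_s}|0\rangle$$ if $s$ is even, and by the same formula with $e^{-\theta}\phi^{[\beta]}_0$ inserted immediately before $|0\rangle$ (and the same factor $2^{-s}$) if $s$ is odd. Write $o_n=o_{(n)}$. Let $\lambda=(\lambda_1>\dots>\lambda_r>0)$ be a strict partition, $r\ge 0$, and let $r'$ be the smallest even integer with $r'\ge r$. Then $$o_\lambda(x)=\mathrm{Pf}(\kappa_{i,j})_{1\le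 i<j\le r'},$$ where $$\kappa_{i,j}=\begin{cases}\displaystyle\sum_{k=0}^{\infty}\sum_{l=0}^{\infty}\beta^{k+l}\binom{1-i}{k}\binom{2-j}{l}\,o_{(\lambda_i-k,\lambda_j-l)}(x), & j\ne r+1,\\[2mm] \displaystyle\sum_{k=0}^{\infty}\beta^{k}\binom{1-i}{k}\,o_{\lambda_i-k}(x), & j=r+1,\end{cases}$$ and each of these sums has only finitely many nonzero terms. Here $$\mathrm{Pf}(a_{i,j})_{1\le i<j\le 2s}=\sum_\sigma \mathrm{sgn}(\sigma)\,a_{\sigma(1),\sigma(2)}\cdots a_{\sigma(2s-1),\sigma(2s)},$$ the sum being over the permutations $\sigma$ of $\{1,\dots,2s\}$ with $\sigma(1)<\sigma(3)<\dots<\sigma(2s-1)$ and $\sigma(2t-1)<\sigma(2t)$ for $1\le t\le s$. -/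

import Mathlib

/-!  Neutral fermions, their Fock space, the `β`-deformed operators, and the symmetric functions
`o_λ`.  Everything is defined over a commutative `ℚ`-algebra `R`, with `β : R` and (where they
occur) power sums `p : ℕ → R`; the theorem takes for `R` the power series in `x₁, x₂, …`
over `ℚ(β)`.  All the sums `∑ᶠ` below have only finitely many nonzero terms. -/

noncomputable section

namespace NeutralFermion

/-- The Fock space.  The finite set `{n₁ > n₂ > ⋯ > n_r ≥ 0}` stands for the basis vector
`φ_{n₁} φ_{n₂} ⋯ φ_{n_r} |0⟩`. -/
abbrev Fock (R : Type*) [CommRing R] : Type _ := Finset ℕ →₀ R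

section Fermions

variable (R : Type*) [CommRing R]

/-- The vacuum vector `|0⟩`. -/
def vac : Fock R := Finsupp.single ∅ 1

/-- The vacuum expectation `|v⟩ ↦ ⟨0|v⟩`: the functional with `⟨0|0⟩ = 1` that vanishes on all
other basis vectors. -/
def vev : Fock R →ₗ[R] R := Finsupp.lapply ∅

/-- `φ_n` applied to the basis vector of `S`: moving `φ_n` past the `φ_s` with `s > |n|` gives the
sign; then one uses `φ_n² = 0` (`n ≠ 0`), `φ_0² = 1`,
`φ_{-a} φ_a = 2 (-1)^a - φ_a φ_{-a}` (`a > 0`), and `φ_{-a} |0⟩ = 0` (`a > 0`). -/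
def phiBasis (n : ℤ) (S : Finset ℕ) : Fock R :=
  if n.natAbs ∈ S then
    if 0 < n then 0
    else Finsupp.single (S.erase n.natAbs)
      ((-1) ^ (S.filter (fun s => n.natAbs < s)).card *
        (if n = 0 then 1 else 2 * (-1) ^ n.natAbs))
  else
    if n < 0 then 0
    else Finsupp.single (insert n.natAbs S) ((-1) ^ (S.filter (fun s => n.natAbs < s)).card)

/-- The neutral fermion `φ_n`, acting on the Fock space. -/
def phi (n : ℤ) : Fock R →ₗ[R] Fock R := Finsupp.linearCombination R (phiBasis R n)

end Fermions

section Deformed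

variable {R : Type*} [CommRing R] [Algebra ℚ R]

/-- The Heisenberg generator `b_m = (1/4) ∑_{i ∈ ℤ} (-1)^i φ_{-i-m} φ_i` (used for odd `m`). -/
def heis (m : ℤ) (v : Fock R) : Fock R :=
  (1 / 4 : ℚ) • ∑ᶠ i : ℤ, (i.negOnePow : ℤ) • phi R (-i - m) (phi R i v)

/-- The coefficient of `φ_m` in `φ^{(β)}_n`, that is, of `z^n` in `(z + β/2)^m` (expanded in
powers of `z⁻¹`). -/
def bphiCoeff (β : R) (n m : ℤ) : R :=
  if n ≤ m then Ring.choose m (m - n).toNat • ((1 / 2 : ℚ) • β) ^ (m - n).toNat else 0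

/-- The dual `β`-deformed neutral fermion `φ^{[β]}_n = (-1)^n (φ^{(-β)}_{-n})^*`, where `*` is
the anti-involution with `(φ_m)^* = (-1)^m φ_{-m}`. -/
def dbphi (β : R) (n : ℤ) (v : Fock R) : Fock R :=
  (n.negOnePow : ℤ) • ∑ᶠ m : ℤ, bphiCoeff (-β) (-n) m • (m.negOnePow : ℤ) • phi R (-m) v

/-- `θ = 2 ∑_{m = 1, 3, 5, …} (β/2)^m b_m / m`, where `m = 2 j + 1`. -/
def theta (β : R) (v : Fock R) : Fock R :=
  (2 : ℚ) • ∑ᶠ j : ℕ, ((1 / 2 : ℚ) • β) ^ (2 * j + 1) •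
    (1 / (2 * j + 1 : ℚ)) • heis (2 * j + 1) v

/-- `exp(-θ)`. -/
def expNegTheta (β : R) (v : Fock R) : Fock R :=
  ∑ᶠ k : ℕ, ((-1 : ℚ) ^ k / (k.factorial : ℚ)) • (theta β)^[k] v

/-- `b^{[β]}_m = (b^{(β)}_{-m})^*` for `m > 0`.  Here `b^{(β)}_{-m}` is obtained from the expansion
of `((X - β/2)^{-m} - (-X - β/2)^{-m}) / 2` in powers of `X⁻¹`, namely the odd part
`∑_{j ≥ 0, m + j odd} binom(-m, j) (-β/2)^j X^{-m-j}` of `(X - β/2)^{-m}`, by `X^{-n} ↦ b_{-n}`;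
and `(b_{-n})^* = b_n`. -/
def dheis (β : R) (m : ℕ) (v : Fock R) : Fock R :=
  ∑ᶠ j : ℕ, if Odd (m + j) then
    Ring.choose (-(m : ℤ)) j • ((-1 / 2 : ℚ) • β) ^ j • heis ((m + j : ℕ) : ℤ) v else 0

/-- `H^{[β]} = 2 ∑_{m ≥ 1} (p_m / m) b^{[β]}_m`. -/
def dham (β : R) (p : ℕ → R) (v : Fock R) : Fock R :=
  (2 : ℚ) • ∑ᶠ m : ℕ, (1 / (m + 1 : ℚ)) • p (m + 1) • dheis β (m + 1) v

/-- `exp(H^{[β]})`. -/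
def expDham (β : R) (p : ℕ → R) (v : Fock R) : Fock R :=
  ∑ᶠ k : ℕ, (1 / (k.factorial : ℚ)) • (dham β p)^[k] v

/-- `|n₁, …, n_r⟩^g = e^{-θ} φ^{[β]}_{n₁} e^{-θ} φ^{[β]}_{n₂} ⋯ e^{-θ} φ^{[β]}_{n_r} |0⟩`. -/
def gket (β : R) : List ℤ → Fock R
  | [] => vac R
  | n :: l => expNegTheta β (dbphi β n (gket β l))

/-- `2^{-r} ⟨0| e^{H^{[β]}} |n₁, …, n_r⟩^g` for even `r`, and
`2^{-r} ⟨0| e^{H^{[β]}} |n₁, …, n_r, 0⟩^g` for odd `r`. -/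
def oSeq (β : R) (p : ℕ → R) (n : List ℤ) : R :=
  (1 / 2 : ℚ) ^ n.length •
    vev R (expDham β p (gket β (if Even n.length then n else n ++ [0])))

end Deformed

/-- The field `k = ℚ(β)`. -/
abbrev K : Type := RatFunc ℚ

/-- Formal power series over `k` in `x₁, x₂, …`; they contain the symmetric functions. -/
abbrev Ser : Type := MvPowerSeries ℕ K

/-- The indeterminate `β`. -/
def beta : Ser := MvPowerSeries.C RatFunc.X

/-- The power sum `p_n(x) = x₁^n + x₂^n + ⋯` (`n ≥ 1`). -/
def psum (n : ℕ) : Ser :=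
  fun m => open Classical in if ∃ i : ℕ, m = Finsupp.single i n then 1 else 0

/-- The symmetric function `o_{(n₁, …, n_r)}(x)`, for any integers `n₁, …, n_r`. -/
def o (n : List ℤ) : Ser := oSeq beta psum n

/-- Strict partitions `λ₁ > ⋯ > λ_r > 0`. -/
def IsStrictPartition (lam : List ℕ) : Prop :=
  lam.Pairwise (· > ·) ∧ ∀ a ∈ lam, 0 < a

/-- The `i`-th part `λ_i`, with `i` counted from `1`. -/
def part (lam : List ℕ) (i : ℕ) : ℤ := (lam.getD (i - 1) 0 : ℕ)

/-- The term of index `(k, l)` in `κ_{i,j}` for `j ≠ r + 1`. -/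
def kappaTerm₂ (lam : List ℕ) (i j : ℕ) (kl : ℕ × ℕ) : Ser :=
  beta ^ (kl.1 + kl.2) *
    ((Ring.choose (1 - (i : ℤ)) kl.1 * Ring.choose (2 - (j : ℤ)) kl.2) •
      o [part lam i - kl.1, part lam j - kl.2])

/-- The term of index `k` in `κ_{i,r+1}`. -/
def kappaTerm₁ (lam : List ℕ) (i : ℕ) (k : ℕ) : Ser :=
  beta ^ k * (Ring.choose (1 - (i : ℤ)) k • o [part lam i - k])

/-- `κ_{i,j}` for `λ` of length `r` (with `i`, `j` counted from `1`). -/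
def kappa (lam : List ℕ) (i j : ℕ) : Ser :=
  if j = lam.length + 1 then ∑ᶠ k : ℕ, kappaTerm₁ lam i k
  else ∑ᶠ kl : ℕ × ℕ, kappaTerm₂ lam i j kl

/-- The Pfaffian of an array `(a_{i,j})_{1 ≤ i < j ≤ 2s}`; the indices are counted from `1`. -/
def pfaffian {R : Type*} [CommRing R] (s : ℕ) (a : ℕ → ℕ → R) : R :=
  open Classical in
  ∑ σ ∈ (Finset.univ : Finset (Equiv.Perm (Fin (2 * s)))).filter (fun σ =>
      (∀ t u : Fin s, t < u →
        σ ⟨2 * (t : ℕ), by omega⟩ < σ ⟨2 * (u : ℕ), by omega⟩) ∧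
      (∀ t : Fin s, σ ⟨2 * (t : ℕ), by omega⟩ < σ ⟨2 * (t : ℕ) + 1, by omega⟩)),
    (Equiv.Perm.sign σ : ℤ) •
      ∏ t : Fin s, a ((σ ⟨2 * (t : ℕ), by omega⟩ : ℕ) + 1)
        ((σ ⟨2 * (t : ℕ) + 1, by omega⟩ : ℕ) + 1)

end NeutralFermion

end

/-! A Laurent series `a = ∑ a_n t^n` gives a one-particle operator `field a = ∑ a_n φ_{-n}`. Every
fermion in the formula has this form, and the two facts below reduce the theorem to multiplication
of series in one variable.

Wick: the annihilating part of `field a` anticommutes with `field b` up to a scalar, the two-point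
function `pair a b`. Moving it to the right until it kills the vacuum expands `⟨0| f_1 ⋯ f_{2s} |0⟩`
in the way a Pfaffian expands along its first row (`vev_ket_eq_pfaffian`).

Heisenberg: for odd `m > 0`, `b_m` kills the vacuum and `[b_m, field a] = field (t^m a)`. So `e^{H}`
and `e^{-θ}` fix the vacuum and multiply each one-particle series by a power series
(`IsHeis.expOp_field`). Pushed to the right, `e^{H}` leaves a vacuum expectation of one-particle
operators, so the Pfaffian formula also holds with `⟨0| e^{H}` on the left (`covac_ket`).

For `e^{-θ}` the multiplier is `c = (1 - βt/2)/(1 + βt/2)`, and the `i`-th fermion has `i` copies of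
`e^{-θ}` to its left, so its series is `c^i d_{λ_i}`, where `d_n` is the series of `φ^{[β]}_n`. Now
`d_{n-1} = q d_n` with `q = t/(1 - βt/2)`, and `c = (1 + βq)^{-1}`. Hence `c^i d_n = ∑ β^k
binom(1-i, k) c d_{n-k}`, and in the same way `c^j d_n` is reduced to `c^2 d_{n-l}` with `binom(2-j,
l)`. As `o_{(a,b)}` is built from `c d_a` and `c^2 d_b`, the Pfaffian entries are the sums `κ_{i,j}`
(`kappa_of_ne`). For odd `r` the last vector is `c^{r+1} d_0 |0⟩`, in which the power of `c` is
immaterial (`kappa_last`).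

A degree filtration, bounded below by `0`, makes all the sums finite: a series starting at `t^k`
lowers the degree by at least `k`. -/

noncomputable section

namespace NeutralFermion

/-! ### Creation and annihilation operators, and the Clifford relations. -/

section Modes

variable (R : Type*) [CommRing R]

/-- The sign picked up by a mode `a` moved past the modes of `S` above it. -/
def modeSign (a : ℕ) (S : Finset ℕ) : R := (-1) ^ (S.filter (fun s => a < s)).card

/-- The creation operator of the mode `a`. -/
def cre (a : ℕ) : Fock R →ₗ[R] Fock R :=
  Finsupp.linearCombination R fun S =>
    if a ∈ S then 0 else Finsupp.single (insert a S) (modeSign R a S)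

/-- The annihilation operator of the mode `a`. -/
def ann (a : ℕ) : Fock R →ₗ[R] Fock R :=
  Finsupp.linearCombination R fun S =>
    if a ∈ S then Finsupp.single (S.erase a) (modeSign R a S) else 0

variable {R}

theorem cre_single (a : ℕ) (S : Finset ℕ) (r : R) :
    cre R a (Finsupp.single S r) =
      if a ∈ S then 0 else Finsupp.single (insert a S) (r * modeSign R a S) := by
  rw [cre, Finsupp.linearCombination_single]; split_ifs <;> simp

theorem ann_single (a : ℕ) (S : Finset ℕ) (r : R) :
    ann R a (Finsupp.single S r) =
      if a ∈ S then Finsupp.single (S.erase a) (r * modeSign R a S) else 0 := by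
  rw [ann, Finsupp.linearCombination_single]; split_ifs <;> simp

theorem modeSign_insert {a b : ℕ} {S : Finset ℕ} (hb : b ∉ S) :
    modeSign R a (insert b S) = (if a < b then -1 else 1) * modeSign R a S := by
  rw [modeSign, Finset.filter_insert]
  split_ifs with h
  · rw [Finset.card_insert_of_notMem (by simp [hb]), pow_succ, modeSign, mul_comm]
  · simp [modeSign]

theorem modeSign_erase {a b : ℕ} {S : Finset ℕ} (hb : b ∈ S) :
    modeSign R a (S.erase b) = (if a < b then -1 else 1) * modeSign R a S := by
  have h := modeSign_insert (R := R) (a := a) (Finset.notMem_erase b S)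
  rw [Finset.insert_erase hb] at h
  rw [h]; split_ifs <;> simp

theorem modeSign_mul_self (a : ℕ) (S : Finset ℕ) : modeSign R a S * modeSign R a S = 1 := by
  rw [modeSign, ← mul_pow]; simp

theorem single_neg_add {S T : Finset ℕ} {r s : R} (h : S = T) (hr : r + s = 0) :
    (Finsupp.single S r : Fock R) + Finsupp.single T s = 0 := by
  rw [h, ← Finsupp.single_add, hr, Finsupp.single_zero]

theorem cre_cre (a b : ℕ) (v : Fock R) : cre R a (cre R b v) + cre R b (cre R a v) = 0 := by
  induction v using Finsupp.induction_linear with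
  | zero => simp
  | add x y hx hy =>
    simp only [map_add]; rw [add_add_add_comm, hx, hy, add_zero]
  | single S r =>
    rcases eq_or_ne a b with rfl | hab
    · by_cases h : a ∈ S <;> simp [cre_single, h, -Finsupp.single_mul]
    · by_cases ha : a ∈ S <;> by_cases hb : b ∈ S <;> simp [cre_single, ha, hb, hab, hab.symm, -Finsupp.single_mul]
      apply single_neg_add (Finset.insert_comm _ _ _)
      rw [modeSign_insert hb, modeSign_insert ha]
      rcases lt_or_gt_of_ne hab with h | h <;> simp [h, h.not_gt] <;> ring

theorem ann_ann (a b : ℕ) (v : Fock R) : ann R a (ann R b v) + ann R b (ann R a v) = 0 := by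
  induction v using Finsupp.induction_linear with
  | zero => simp
  | add x y hx hy =>
    simp only [map_add]; rw [add_add_add_comm, hx, hy, add_zero]
  | single S r =>
    rcases eq_or_ne a b with rfl | hab
    · by_cases h : a ∈ S <;> simp [ann_single, h, -Finsupp.single_mul]
    · by_cases ha : a ∈ S <;> by_cases hb : b ∈ S <;> simp [ann_single, ha, hb, hab, hab.symm, -Finsupp.single_mul]
      apply single_neg_add Finset.erase_right_comm
      rw [modeSign_erase hb, modeSign_erase ha]
      rcases lt_or_gt_of_ne hab with h | h <;> simp [h, h.not_gt] <;> ring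

theorem ann_cre (a b : ℕ) (v : Fock R) :
    ann R a (cre R b v) + cre R b (ann R a v) = if a = b then v else 0 := by
  induction v using Finsupp.induction_linear with
  | zero => simp
  | add x y hx hy =>
    simp only [map_add]; rw [add_add_add_comm, hx, hy]; split_ifs <;> simp
  | single S r =>
    rcases eq_or_ne a b with rfl | hab
    · by_cases h : a ∈ S
      · simp [cre_single, ann_single, h, modeSign_erase h, mul_assoc, modeSign_mul_self, -Finsupp.single_mul]
      · simp [cre_single, ann_single, h, modeSign_insert h, mul_assoc, modeSign_mul_self, -Finsupp.single_mul]
    · by_cases ha : a ∈ S <;> by_cases hb : b ∈ S <;>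
        simp [ann_single, cre_single, ha, hb, hab, hab.symm, -Finsupp.single_mul]
      apply single_neg_add (Finset.erase_insert_of_ne hab.symm)
      rw [modeSign_insert hb, modeSign_erase ha]
      rcases lt_or_gt_of_ne hab with h | h <;> simp [h, h.not_gt] <;> ring

variable (R) in
/-- The part of `φ_n` that creates. -/
def phiCre (n : ℤ) : Fock R →ₗ[R] Fock R := if 0 ≤ n then cre R n.natAbs else 0

variable (R) in
/-- The part of `φ_n` that annihilates. -/
def phiAnn (n : ℤ) : Fock R →ₗ[R] Fock R :=
  if n ≤ 0 then (if n = 0 then (1 : R) else 2 * (-1) ^ n.natAbs) • ann R n.natAbs else 0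

/-- Only `φ_0` has both parts: `φ_n` creates for `n > 0` and annihilates for `n < 0`. -/
theorem phi_eq (n : ℤ) : phi R n = phiCre R n + phiAnn R n := by
  ext S : 2
  simp only [LinearMap.comp_apply, Finsupp.lsingle_apply, LinearMap.add_apply, phi,
    Finsupp.linearCombination_single, one_smul, phiBasis, phiCre, phiAnn]
  rcases lt_trichotomy n 0 with h | rfl | h
  · by_cases hS : n.natAbs ∈ S <;>
      simp [h, h.not_gt, h.not_ge, h.le, h.ne, hS, ann_single, modeSign, mul_comm]
  · by_cases hS : 0 ∈ S <;> simp [hS, cre_single, ann_single, modeSign]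
  · by_cases hS : n.natAbs ∈ S <;> simp [h, h.not_gt, h.not_ge, h.le, hS, cre_single, modeSign]

theorem phiCre_phiCre (m n : ℤ) (v : Fock R) :
    phiCre R m (phiCre R n v) + phiCre R n (phiCre R m v) = 0 := by
  unfold phiCre; split_ifs <;> simp [cre_cre]

theorem phiAnn_phiAnn (m n : ℤ) (v : Fock R) :
    phiAnn R m (phiAnn R n v) + phiAnn R n (phiAnn R m v) = 0 := by
  unfold phiAnn
  by_cases hm : m ≤ 0 <;> by_cases hn : n ≤ 0 <;> simp only [hm, hn, if_true, if_false] <;>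
    simp only [LinearMap.smul_apply, LinearMap.zero_apply, map_smul, map_zero, smul_zero, add_zero]
  rw [smul_comm, ← smul_add, ← smul_add, ann_ann, smul_zero, smul_zero]

/-- The scalar `{phiAnn m, φ_n}`. -/
theorem phiAnn_phiCre (m n : ℤ) (v : Fock R) :
    phiAnn R m (phiCre R n v) + phiCre R n (phiAnn R m v) =
      (if m + n = 0 ∧ m ≤ 0 then (if m = 0 then (1 : R) else 2 * (-1) ^ m.natAbs) else 0) • v := by
  unfold phiAnn phiCre
  by_cases hm : m ≤ 0
  · by_cases hn : 0 ≤ n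
    · simp only [hm, hn, if_true, LinearMap.smul_apply, map_smul, ← smul_add, ann_cre, and_true]
      have : m.natAbs = n.natAbs ↔ m + n = 0 := by omega
      simp only [this]
      by_cases h : m + n = 0 <;> simp [h]
    · have : m + n ≠ 0 := by omega
      simp [hm, hn, this]
  · simp [hm]

theorem phiAnn_phi (m n : ℤ) (v : Fock R) :
    phiAnn R m (phi R n v) + phi R n (phiAnn R m v) =
      (if m + n = 0 ∧ m ≤ 0 then (if m = 0 then (1 : R) else 2 * (-1) ^ m.natAbs) else 0) • v := by
  rw [← phiAnn_phiCre, phi_eq]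
  simp only [LinearMap.add_apply, map_add]
  rw [add_add_add_comm, phiAnn_phiAnn, add_zero]

theorem phi_phi (m n : ℤ) (v : Fock R) :
    phi R m (phi R n v) + phi R n (phi R m v) =
      (if m + n = 0 then 2 * (m.negOnePow : ℤ) else 0 : ℤ) • v := by
  have h1 := phiAnn_phiCre m n v
  have h2 := phiAnn_phiCre n m v
  have h : phi R m (phi R n v) + phi R n (phi R m v) =
      (phiCre R m (phiCre R n v) + phiCre R n (phiCre R m v)) +
      (phiAnn R m (phiAnn R n v) + phiAnn R n (phiAnn R m v)) +
      (phiAnn R m (phiCre R n v) + phiCre R n (phiAnn R m v)) +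
      (phiAnn R n (phiCre R m v) + phiCre R m (phiAnn R n v)) := by
    simp only [phi_eq, LinearMap.add_apply, map_add]; abel
  rw [h, phiCre_phiCre, phiAnn_phiAnn, h1, h2, zero_add, zero_add, ← add_smul,
    ← Int.cast_smul_eq_zsmul R]
  congr 1
  have hs (k : ℤ) : (((k.negOnePow : ℤˣ) : ℤ) : R) = (-1) ^ k.natAbs := by
    rcases Int.even_or_odd k with hk | hk
    · rw [Int.negOnePow_even _ hk, (Int.natAbs_even.2 hk).neg_one_pow]; simp
    · rw [Int.negOnePow_odd _ hk, (Int.natAbs_odd.2 hk).neg_one_pow]; simp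
  by_cases hmn : m + n = 0
  · rcases lt_trichotomy m 0 with hm | rfl | hm
    · have hn : ¬ n ≤ 0 := by omega
      simp [hmn, hm.le, hn, hm.ne, hs]
    · have : n = 0 := by omega
      subst this; norm_num
    · have hn : n ≤ 0 := by omega
      have hn' : n ≠ 0 := by omega
      have he : n.natAbs = m.natAbs := by omega
      simp [hmn, add_comm n m, hm.not_ge, hn, hn', hs, he]
  · simp [hmn, add_comm n m]

theorem vac_ann (a : ℕ) : ann R a (vac R) = 0 := by simp [vac, ann_single]

theorem phiAnn_vac (n : ℤ) : phiAnn R n (vac R) = 0 := by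
  unfold phiAnn; split_ifs <;> simp [vac_ann]

theorem vev_vac : vev R (vac R) = 1 := by simp [vev, vac]

theorem vev_cre (a : ℕ) (v : Fock R) : vev R (cre R a v) = 0 := by
  induction v using Finsupp.induction_linear with
  | zero => simp
  | add x y hx hy => simp [hx, hy]
  | single S r => rw [cre_single]; split_ifs <;> simp [vev]

theorem vev_phi (n : ℤ) (v : Fock R) : vev R (phi R n v) = vev R (phiAnn R n v) := by
  rw [phi_eq, LinearMap.add_apply, map_add]
  unfold phiCre; split_ifs <;> simp [vev_cre]

end Modes

/-! ### The degree filtration of the Fock space. -/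

section Filtration

variable {R : Type*} [CommRing R]

variable (R) in
/-- The span of the basis vectors of degree at most `d`. -/
def fil (d : ℤ) : Submodule R (Fock R) :=
  Finsupp.supported R R {S : Finset ℕ | ((∑ s ∈ S, s : ℕ) : ℤ) ≤ d}

theorem fil_mono {d e : ℤ} (h : d ≤ e) : fil R d ≤ fil R e :=
  Finsupp.supported_mono fun _ hS => le_trans hS h

theorem single_mem_fil {S : Finset ℕ} {d : ℤ} (h : ((∑ s ∈ S, s : ℕ) : ℤ) ≤ d) (r : R) :
    (Finsupp.single S r : Fock R) ∈ fil R d := Finsupp.single_mem_supported R r h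

/-- Basis vectors have nonnegative degree; this is the source of every finiteness statement below.
-/
theorem fil_neg {d : ℤ} (hd : d < 0) {v : Fock R} (hv : v ∈ fil R d) : v = 0 := by
  have : {S : Finset ℕ | ((∑ s ∈ S, s : ℕ) : ℤ) ≤ d} = ∅ := by
    ext S; simp only [Set.mem_ofPred_eq, Set.mem_empty_iff_false, iff_false]; omega
  rw [fil, this, Finsupp.supported_empty] at hv
  simpa using hv

theorem vac_mem_fil : vac R ∈ fil R 0 := single_mem_fil (by simp) 1

theorem exists_mem_fil (v : Fock R) : ∃ d : ℕ, v ∈ fil R d := by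
  induction v using Finsupp.induction_linear with
  | zero => exact ⟨0, zero_mem _⟩
  | add x y hx hy =>
    obtain ⟨d, hd⟩ := hx
    obtain ⟨e, he⟩ := hy
    exact ⟨max d e, add_mem (fil_mono (by simp) hd) (fil_mono (by simp) he)⟩
  | single S r => exact ⟨_, single_mem_fil le_rfl r⟩

theorem map_mem_fil {T : Fock R →ₗ[R] Fock R} {d e : ℤ}
    (hT : ∀ S : Finset ℕ, ((∑ s ∈ S, s : ℕ) : ℤ) ≤ d → T (Finsupp.single S 1) ∈ fil R e)
    {v : Fock R} (hv : v ∈ fil R d) : T v ∈ fil R e := by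
  rw [fil, Finsupp.supported_eq_span_single] at hv
  refine Submodule.span_induction (p := fun v _ => T v ∈ fil R e) ?_ ?_ ?_ ?_ hv
  · rintro _ ⟨S, hS, rfl⟩; exact hT S hS
  · simp
  · intro x y _ _ hx hy; rw [map_add]; exact add_mem hx hy
  · intro r x _ hx; rw [map_smul]; exact Submodule.smul_mem _ _ hx

theorem phiCre_mem_fil (n : ℤ) {d : ℤ} {v : Fock R} (hv : v ∈ fil R d) :
    phiCre R n v ∈ fil R (d + n) := by
  refine map_mem_fil (fun S hS => ?_) hv
  unfold phiCre; split_ifs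
  · rw [cre_single]; split_ifs with h
    · simp
    · apply single_mem_fil; rw [Finset.sum_insert h]; have := Int.natAbs_of_nonneg (by assumption : 0 ≤ n); omega
  · simp

theorem phiAnn_mem_fil (n : ℤ) {d : ℤ} {v : Fock R} (hv : v ∈ fil R d) :
    phiAnn R n v ∈ fil R (d + n) := by
  refine map_mem_fil (fun S hS => ?_) hv
  by_cases hn : n ≤ 0
  · rw [phiAnn, if_pos hn, LinearMap.smul_apply, ann_single]
    refine Submodule.smul_mem _ _ ?_
    split_ifs with h
    · apply single_mem_fil
      have := Finset.sum_erase_add S (fun s : ℕ => s) h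
      omega
    · simp
  · simp [phiAnn, hn]

theorem phi_mem_fil (n : ℤ) {d : ℤ} {v : Fock R} (hv : v ∈ fil R d) :
    phi R n v ∈ fil R (d + n) := by
  rw [phi_eq]; exact add_mem (phiCre_mem_fil n hv) (phiAnn_mem_fil n hv)

end Filtration

/-! ### One-particle operators and Wick's theorem. -/

section Fields

variable {R : Type*} [CommRing R]

/-- The Laurent series `a` has no terms of degree less than `k`. -/
def OrderGE (a : LaurentSeries R) (k : ℤ) : Prop := ∀ n < k, a.coeff n = 0

theorem exists_orderGE (a : LaurentSeries R) : ∃ k, OrderGE a k :=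
  ⟨a.order, fun _ hn => HahnSeries.coeff_eq_zero_of_lt_order hn⟩

theorem OrderGE.mono {a : LaurentSeries R} {k l : ℤ} (h : OrderGE a k) (hl : l ≤ k) :
    OrderGE a l := fun n hn => h n (hn.trans_le hl)

theorem OrderGE.single_mul {a : LaurentSeries R} {k : ℤ} (m : ℤ) (ha : OrderGE a k) :
    OrderGE (HahnSeries.single m 1 * a) (k + m) := fun n hn => by
  rw [HahnSeries.coeff_single_mul, ha _ (by omega), mul_zero]

/-- A family of operators, the `n`-th of which lowers the degree by `n`. -/
def Lowering (g : ℤ → Fock R →ₗ[R] Fock R) : Prop :=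
  ∀ (n d : ℤ) (v : Fock R), v ∈ fil R d → g n v ∈ fil R (d - n)

theorem Lowering.support_finite {g : ℤ → Fock R →ₗ[R] Fock R} (hg : Lowering g)
    (a : LaurentSeries R) (v : Fock R) :
    (Function.support fun n => a.coeff n • g n v).Finite := by
  obtain ⟨k, hk⟩ := exists_orderGE a
  obtain ⟨d, hd⟩ := exists_mem_fil v
  refine (Set.finite_Icc k d).subset fun n hn => ?_
  by_contra h
  apply hn
  rw [Set.mem_Icc, not_and_or, not_le, not_le] at h
  rcases h with h | h
  · simp [hk n h]
  · simp [fil_neg (by omega) (hg n d v hd)]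

/-- The operator `∑ a_n g_n`, for `a = ∑ a_n t^n`. -/
def modeSum (g : ℤ → Fock R →ₗ[R] Fock R) (hg : Lowering g) :
    LaurentSeries R →ₗ[R] Fock R →ₗ[R] Fock R :=
  LinearMap.mk₂ R (fun a v => ∑ᶠ n, a.coeff n • g n v)
    (fun a b v => by
      simp only [HahnSeries.coeff_add, add_smul]
      exact finsum_add_distrib (hg.support_finite a v) (hg.support_finite b v))
    (fun r a v => by
      simp only [HahnSeries.coeff_smul, smul_assoc]
      exact (smul_finsum' r (hg.support_finite a v)).symm)
    (fun a v w => by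
      simp only [map_add, smul_add]
      exact finsum_add_distrib (hg.support_finite a v) (hg.support_finite a w))
    (fun r a v => by
      simp only [map_smul, smul_comm _ r]
      exact (smul_finsum' r (hg.support_finite a v)).symm)

theorem modeSum_apply {g : ℤ → Fock R →ₗ[R] Fock R} (hg : Lowering g)
    (a : LaurentSeries R) (v : Fock R) : modeSum g hg a v = ∑ᶠ n, a.coeff n • g n v := rfl

theorem map_modeSum {g : ℤ → Fock R →ₗ[R] Fock R} (hg : Lowering g) (T : Fock R →ₗ[R] Fock R)
    (a : LaurentSeries R) (v : Fock R) :
    T (modeSum g hg a v) = ∑ᶠ n, a.coeff n • T (g n v) := by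
  rw [modeSum_apply]
  simpa using T.toAddMonoidHom.map_finsum (hg.support_finite a v)

theorem finite_support_map {g : ℤ → Fock R →ₗ[R] Fock R} (hg : Lowering g)
    (T : Fock R →ₗ[R] Fock R) (a : LaurentSeries R) (v : Fock R) :
    (Function.support fun n => a.coeff n • T (g n v)).Finite :=
  (hg.support_finite a v).subset fun n hn h => hn (by
    simp only at h
    simp only [← map_smul, h, map_zero])

theorem finsum_mem_submodule {ι M : Type*} [AddCommGroup M] [Module R M] (p : Submodule R M)
    {f : ι → M} (h : ∀ i, f i ∈ p) : ∑ᶠ i, f i ∈ p :=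
  finsum_induction (· ∈ p) p.zero_mem (fun _ _ => p.add_mem) h

theorem modeSum_mem_fil {g : ℤ → Fock R →ₗ[R] Fock R} (hg : Lowering g)
    {a : LaurentSeries R} {k d : ℤ} (ha : OrderGE a k) {v : Fock R} (hv : v ∈ fil R d) :
    modeSum g hg a v ∈ fil R (d - k) := by
  rw [modeSum_apply]
  refine finsum_mem_submodule _ fun n => ?_
  by_cases hn : n < k
  · simp [ha n hn]
  · exact Submodule.smul_mem _ _ (fil_mono (by omega) (hg n d v hv))

theorem lowering_phi : Lowering fun n => phi R (-n) := fun n _ _ hv => phi_mem_fil (-n) hv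

theorem lowering_phiAnn : Lowering fun n => phiAnn R (-n) := fun n _ _ hv => phiAnn_mem_fil (-n) hv

variable (R) in
/-- The one-particle operator `∑ a_n φ_{-n}` attached to `∑ a_n t^n`. -/
def field : LaurentSeries R →ₗ[R] Fock R →ₗ[R] Fock R := modeSum _ lowering_phi

variable (R) in
/-- The annihilating part of `field`. -/
def contr : LaurentSeries R →ₗ[R] Fock R →ₗ[R] Fock R := modeSum _ lowering_phiAnn

theorem field_single (n : ℤ) (r : R) (v : Fock R) :
    field R (HahnSeries.single n r) v = r • phi R (-n) v := by
  rw [field, modeSum_apply, finsum_eq_single _ n fun m hm => by simp [HahnSeries.coeff_single_of_ne hm]]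
  simp

theorem field_mem_fil {a : LaurentSeries R} {k d : ℤ} (ha : OrderGE a k) {v : Fock R}
    (hv : v ∈ fil R d) : field R a v ∈ fil R (d - k) := modeSum_mem_fil _ ha hv

theorem field_eq_zero {a : LaurentSeries R} {k d : ℤ} (ha : OrderGE a k) {v : Fock R}
    (hv : v ∈ fil R d) (h : d < k) : field R a v = 0 :=
  fil_neg (by omega) (field_mem_fil ha hv)

theorem phiAnn_field (m : ℤ) (b : LaurentSeries R) (v : Fock R) :
    phiAnn R m (field R b v) + field R b (phiAnn R m v) =
      (b.coeff m * if m ≤ 0 then (if m = 0 then (1 : R) else 2 * (-1) ^ m.natAbs) else 0) • v := by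
  rw [field, map_modeSum, modeSum_apply,
    ← finsum_add_distrib (finite_support_map lowering_phi _ _ _) (lowering_phi.support_finite _ _)]
  simp only [← smul_add, phiAnn_phi]
  rw [finsum_eq_single _ m]
  · simp [mul_smul]
  · intro n hn
    rw [if_neg (by omega)]; simp

theorem vev_field (a : LaurentSeries R) (v : Fock R) :
    vev R (field R a v) = vev R (contr R a v) := by
  have h1 := (vev R).toAddMonoidHom.map_finsum (lowering_phi.support_finite a v)
  have h2 := (vev R).toAddMonoidHom.map_finsum (lowering_phiAnn.support_finite a v)
  simp only [LinearMap.toAddMonoidHom_coe, map_smul, vev_phi] at h1 h2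
  rw [field, contr, modeSum_apply, modeSum_apply, h1, h2]

theorem contr_vac (a : LaurentSeries R) : contr R a (vac R) = 0 := by
  simp [contr, modeSum_apply, phiAnn_vac]

/-- The scalar pairs `a_m` with `b_{-m}`, so it is a finite sum: both series are bounded below. -/
theorem exists_contr_field (a b : LaurentSeries R) :
    ∃ s : R, ∀ v, contr R a (field R b v) + field R b (contr R a v) = s • v := by
  refine ⟨∑ᶠ m, a.coeff m * (b.coeff (-m) *
    if -m ≤ 0 then (if -m = 0 then (1 : R) else 2 * (-1) ^ (-m).natAbs) else 0), fun v => ?_⟩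
  rw [finsum_smul']
  · rw [contr, map_modeSum, modeSum_apply,
      ← finsum_add_distrib (lowering_phiAnn.support_finite _ _) (finite_support_map lowering_phiAnn _ _ _)]
    simp only [← smul_add, phiAnn_field, mul_smul]
  · obtain ⟨k, hk⟩ := exists_orderGE a
    obtain ⟨l, hl⟩ := exists_orderGE b
    refine (Set.finite_Icc k (-l)).subset fun n hn => ?_
    by_contra h
    apply hn
    rw [Set.mem_Icc, not_and_or, not_le, not_le] at h
    rcases h with h | h
    · simp [hk n h]
    · simp [hl (-n) (by omega)]

/-- The two-point function of the fermions. -/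
def pair (a b : LaurentSeries R) : R := vev R (field R a (field R b (vac R)))

theorem contr_field (a b : LaurentSeries R) (v : Fock R) :
    contr R a (field R b v) + field R b (contr R a v) = pair a b • v := by
  obtain ⟨s, hs⟩ := exists_contr_field a b
  -- The scalar does not depend on the vector, so the vacuum determines it.
  have h := congrArg (vev R) (hs (vac R))
  rw [contr_vac, map_zero, add_zero, ← vev_field, map_smul, vev_vac, smul_eq_mul, mul_one] at h
  rw [hs, ← h, pair]

/-- The vector `f_0 f_1 ⋯ f_{n-1} |0⟩`. -/
def ket : (ℕ → LaurentSeries R) → ℕ → Fock R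
  | _, 0 => vac R
  | f, n + 1 => field R (f 0) (ket (fun i => f (i + 1)) n)

/-- The increasing map on `ℕ` that omits the value `j`. -/
def skip (j i : ℕ) : ℕ := if i < j then i else i + 1

/-- The annihilating part travels to the right, leaving a pairing and a sign at each factor, and
dies on the vacuum. -/
theorem contr_ket (a : LaurentSeries R) (n : ℕ) (f : ℕ → LaurentSeries R) :
    contr R a (ket f (n + 1)) =
      ∑ j ∈ Finset.range (n + 1), ((-1) ^ j * pair a (f j)) • ket (fun i => f (skip j i)) n := by
  induction n generalizing f with
  | zero =>
    have := contr_field a (f 0) (vac R)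
    rw [contr_vac, map_zero, add_zero] at this
    simp [ket, this]
  | succ n ih =>
    have h := contr_field a (f 0) (ket (fun i => f (i + 1)) (n + 1))
    rw [ket, eq_sub_of_add_eq h, ih, Finset.sum_range_succ' _ (n + 1), map_sum, sub_eq_add_neg, add_comm,
      ← Finset.sum_neg_distrib]
    congr 1
    · refine Finset.sum_congr rfl fun j _ => ?_
      rw [map_smul, ← neg_smul, ket]
      have : (fun i => f (skip (j + 1) (i + 1))) = fun i => f (skip j i + 1) := by
        funext i; simp only [skip]; split_ifs <;> first | rfl | omega
      rw [this, pow_succ]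
      simp [skip]
    · simp [skip]

theorem vev_ket_add_two (n : ℕ) (f : ℕ → LaurentSeries R) :
    vev R (ket f (n + 2)) = ∑ j ∈ Finset.range (n + 1),
      (-1) ^ j * pair (f 0) (f (j + 1)) * vev R (ket (fun i => f (skip j i + 1)) n) := by
  rw [ket, vev_field, contr_ket, map_sum]
  simp

end Fields

/-! ### Expansion of the Pfaffian along its first row. -/

section Pfaffian
open Equiv

/-- The permutation `0 ↦ 0`, `1 ↦ j + 1` that acts as `τ`, up to relabelling, on the rest. -/
def consPair {n : ℕ} (j : Fin (n + 1)) (τ : Perm (Fin n)) : Perm (Fin (n + 2)) :=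
  Perm.decomposeFin.symm (0, j.cycleRange.symm * Perm.decomposeFin.symm (0, τ))

theorem consPair_zero {n : ℕ} (j : Fin (n + 1)) (τ : Perm (Fin n)) : consPair j τ 0 = 0 := by
  simp [consPair]

theorem consPair_one {n : ℕ} (j : Fin (n + 1)) (τ : Perm (Fin n)) : consPair j τ 1 = j.succ := by
  rw [← Fin.succ_zero_eq_one, consPair, Perm.decomposeFin_symm_apply_succ]
  simp

theorem consPair_succ_succ {n : ℕ} (j : Fin (n + 1)) (τ : Perm (Fin n)) (i : Fin n) :
    consPair j τ i.succ.succ = (j.succAbove (τ i)).succ := by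
  rw [consPair, Perm.decomposeFin_symm_apply_succ]
  simp

theorem sign_consPair {n : ℕ} (j : Fin (n + 1)) (τ : Perm (Fin n)) :
    Perm.sign (consPair j τ) = (-1) ^ (j : ℕ) * Perm.sign τ := by
  simp [consPair, Perm.decomposeFin.symm_sign, Fin.sign_cycleRange]

theorem consPair_injective {n : ℕ} :
    Function.Injective fun p : Fin (n + 1) × Perm (Fin n) => consPair p.1 p.2 := by
  rintro ⟨j, τ⟩ ⟨j', τ'⟩ h
  simp only at h
  obtain rfl : j = j' := by
    have := congrArg (fun σ => σ 1) h
    simpa [consPair_one] using this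
  congr 1
  ext1 i
  have := congrArg (fun σ => σ i.succ.succ) h
  simpa [consPair_succ_succ] using this

theorem exists_consPair {n : ℕ} (σ : Perm (Fin (n + 2))) (h : σ 0 = 0) :
    ∃ j τ, consPair j τ = σ := by
  obtain ⟨⟨p, ρ⟩, rfl⟩ := Perm.decomposeFin.symm.surjective σ
  rw [Perm.decomposeFin_symm_apply_zero] at h
  subst h
  -- The cycle sends `ρ 0` to `0`, so the product fixes `0` and restricts to the remaining points.
  obtain ⟨⟨q, τ⟩, hq⟩ := Perm.decomposeFin.symm.surjective ((ρ 0).cycleRange * ρ)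
  have h0 := congrArg (fun σ => σ 0) hq
  simp at h0
  subst h0
  refine ⟨ρ 0, τ, ?_⟩
  rw [consPair, hq]
  congr 2
  ext1 i
  simp

/-- The permutations that index the terms of a Pfaffian. -/
def IsMatching (s : ℕ) (σ : Perm (Fin (2 * s))) : Prop :=
  (∀ t u : Fin s, t < u → σ ⟨2 * (t : ℕ), by omega⟩ < σ ⟨2 * (u : ℕ), by omega⟩) ∧
    (∀ t : Fin s, σ ⟨2 * (t : ℕ), by omega⟩ < σ ⟨2 * (t : ℕ) + 1, by omega⟩)

/-- The value `0` cannot be taken at an odd position or at a later even one, since a smaller value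
would be needed elsewhere. -/
theorem IsMatching.apply_zero {s : ℕ} {σ : Perm (Fin (2 * s + 2))}
    (h : IsMatching (s + 1) σ) : σ 0 = 0 := by
  obtain ⟨x, hx⟩ := σ.surjective 0
  obtain ⟨t, ht | ht⟩ := Nat.even_or_odd' (x : ℕ)
  · rcases Nat.eq_zero_or_pos t with h0 | h0
    · rw [show (0 : Fin (2 * s + 2)) = x from Fin.ext (by simp; omega)]; rw [hx]; exact Fin.ext (by simp; omega)
    · have := h.1 ⟨0, by omega⟩ ⟨t, by omega⟩ h0
      rw [show (⟨2 * ((⟨t, by omega⟩ : Fin (s + 1)) : ℕ), by simp; omega⟩ : Fin (2 * (s + 1))) = x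
        from Fin.ext ht.symm, hx] at this
      exact absurd this (Fin.not_lt_zero _)
  · have := h.2 ⟨t, by omega⟩
    rw [show (⟨2 * ((⟨t, by omega⟩ : Fin (s + 1)) : ℕ) + 1, by simp; omega⟩ : Fin (2 * (s + 1))) = x
        from Fin.ext ht.symm, hx] at this
    exact absurd this (Fin.not_lt_zero _)

theorem isMatching_consPair {s : ℕ} (j : Fin (2 * s + 1)) (τ : Perm (Fin (2 * s))) :
    IsMatching (s + 1) (consPair j τ) ↔ IsMatching s τ := by
  have h0 : consPair j τ ⟨0, by omega⟩ = 0 := consPair_zero j τ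
  have h1 : consPair j τ ⟨1, by omega⟩ = j.succ := consPair_one j τ
  have he (i : ℕ) (hi : i < 2 * s) : consPair j τ ⟨i + 2, by omega⟩ =
      (j.succAbove (τ ⟨i, hi⟩)).succ := consPair_succ_succ j τ ⟨i, hi⟩
  have he0 (t : Fin s) := he (2 * t) (by omega)
  have he1 (t : Fin s) := he (2 * t + 1) (by omega)
  unfold IsMatching
  refine and_congr ?_ ?_
  · constructor
    · intro h t u htu
      have := h t.succ u.succ (Fin.succ_lt_succ_iff.2 htu)
      simp only [Fin.val_succ, Nat.mul_add, mul_one] at this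
      rw [he0, he0] at this
      simpa using this
    · intro h t u htu
      induction u using Fin.cases with
      | zero => exact absurd htu (Fin.not_lt_zero _)
      | succ u =>
        simp only [Fin.val_succ, Nat.mul_add, mul_one]
        rw [he0]
        induction t using Fin.cases with
        | zero => simp only [Fin.val_zero, mul_zero]; rw [h0]; exact Fin.succ_pos _
        | succ t =>
          simp only [Fin.val_succ, Nat.mul_add, mul_one]
          rw [he0]
          simpa using h t u (Fin.succ_lt_succ_iff.1 htu)
  · rw [Fin.forall_fin_succ]
    constructor
    · rintro ⟨-, h⟩ t
      have := h t
      simp only [Fin.val_succ, Nat.mul_add, mul_one, Nat.add_right_comm _ 2 1] at this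
      rw [he0, he1] at this
      simpa using this
    · intro h
      refine ⟨?_, fun t => ?_⟩
      · simp only [Fin.val_zero, mul_zero, zero_add]; rw [h0, h1]; exact Fin.succ_pos _
      · simp only [Fin.val_succ, Nat.mul_add, mul_one, Nat.add_right_comm _ 2 1]
        rw [he0, he1]
        simpa using h t

theorem coe_succAbove_eq_skip {n : ℕ} (j : Fin (n + 1)) (i : Fin n) :
    (j.succAbove i : ℕ) = skip j i := by
  unfold skip Fin.succAbove
  simp only [Fin.lt_def, Fin.val_castSucc]
  split_ifs <;> simp

variable {R : Type*} [CommRing R]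

/-- Expansion of a Pfaffian along the first row. -/
theorem pfaffian_succ (s : ℕ) (a : ℕ → ℕ → R) :
    pfaffian (s + 1) a = ∑ j ∈ Finset.range (2 * s + 1), (-1) ^ j * a 1 (j + 2) *
      pfaffian s (fun i k => a (skip j (i - 1) + 2) (skip j (k - 1) + 2)) := by
  classical
  rw [Finset.sum_range]
  unfold pfaffian
  simp only [Finset.mul_sum]
  rw [← Finset.sum_product']
  symm
  refine Finset.sum_bij (fun p _ => consPair p.1 p.2) ?_ ?_ ?_ ?_
  · rintro ⟨j, τ⟩ h
    rw [Finset.mem_product, Finset.mem_filter] at h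
    exact Finset.mem_filter.2 ⟨Finset.mem_univ _, (isMatching_consPair j τ).2 h.2.2⟩
  · intro p _ q _ h
    exact consPair_injective h
  · intro σ hσ
    have hσ' : IsMatching (s + 1) σ := (Finset.mem_filter.1 hσ).2
    obtain ⟨j, τ, rfl⟩ := exists_consPair σ hσ'.apply_zero
    exact ⟨(j, τ), Finset.mem_product.2 ⟨Finset.mem_univ _, Finset.mem_filter.2
      ⟨Finset.mem_univ _, (isMatching_consPair j τ).1 hσ'⟩⟩, rfl⟩
  · rintro ⟨j, τ⟩ -
    have h0 : consPair j τ ⟨0, by omega⟩ = 0 := consPair_zero j τ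
    have h1 : consPair j τ ⟨1, by omega⟩ = j.succ := consPair_one j τ
    have he (i : ℕ) (hi : i < 2 * s) : consPair j τ ⟨i + 2, by omega⟩ =
        (j.succAbove (τ ⟨i, hi⟩)).succ := consPair_succ_succ j τ ⟨i, hi⟩
    have he0 (t : Fin s) := he (2 * t) (by omega)
    have he1 (t : Fin s) := he (2 * t + 1) (by omega)
    rw [Fin.prod_univ_succ]
    simp only [Fin.val_zero, mul_zero, zero_add, Fin.val_succ, Nat.mul_add, mul_one,
      Nat.add_right_comm _ 2 1]
    rw [h0, h1]
    simp only [he0, he1, sign_consPair, Fin.val_succ, coe_succAbove_eq_skip]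
    simp [← Int.cast_smul_eq_zsmul R]
    ring

/-- Both sides obey the same first-row recursion. -/
theorem vev_ket_eq_pfaffian (s : ℕ) (f : ℕ → LaurentSeries R) :
    vev R (ket f (2 * s)) = pfaffian s fun i k => pair (f (i - 1)) (f (k - 1)) := by
  induction s generalizing f with
  | zero => simp [ket, vev_vac, pfaffian]
  | succ s ih =>
    rw [pfaffian_succ, Nat.mul_succ, vev_ket_add_two]
    refine Finset.sum_congr rfl fun j _ => ?_
    rw [ih]
    rfl

end Pfaffian

/-! ### Operators that act on fermions by multiplication of series. -/

section Heisenberg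

variable {R : Type*} [CommRing R]

variable (R) in
/-- A power series as a Laurent series. -/
abbrev lau : PowerSeries R →+* LaurentSeries R := HahnSeries.ofPowerSeries ℤ R

theorem OrderGE.lau_mul {a : LaurentSeries R} {k : ℤ} (ha : OrderGE a k) (f : PowerSeries R) :
    OrderGE (lau R f * a) k := fun n hn => by
  rw [HahnSeries.coeff_mul]
  refine Finset.sum_eq_zero fun ij hij => ?_
  obtain ⟨-, -, h⟩ := Finset.mem_antidiagonal.1 hij
  by_cases h1 : ij.1 < 0
  · rw [PowerSeries.coeff_coe, if_pos h1, zero_mul]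
  · rw [ha _ (by omega), mul_zero]

theorem OrderGE.lau_mul_of_dvd {a : LaurentSeries R} {k : ℤ} (ha : OrderGE a k)
    {f : PowerSeries R} {m : ℕ} (hf : PowerSeries.X ^ m ∣ f) :
    OrderGE (lau R f * a) (k + m) := by
  obtain ⟨g, rfl⟩ := hf
  rw [map_mul, HahnSeries.ofPowerSeries_X_pow, mul_assoc]
  exact (ha.lau_mul g).single_mul m

theorem lau_smul (r : R) (f : PowerSeries R) : lau R (r • f) = r • lau R f := by
  rw [PowerSeries.smul_eq_C_mul, map_mul, HahnSeries.ofPowerSeries_C, HahnSeries.C_mul_eq_smul]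

/-- `F` is an operator that kills the vacuum and acts on the one-particle operators, by
commutator, as multiplication by `τ`. -/
structure IsHeis (F : Fock R → Fock R) (τ : PowerSeries R) : Prop where
  isLinear : IsLinearMap R F
  vac : F (vac R) = 0
  comm : ∀ a v, F (field R a v) = field R a (F v) + field R (lau R τ * a) v

theorem single_insert_eq_phi {m : ℕ} {S : Finset ℕ} (h : ∀ s ∈ S, s < m) :
    (Finsupp.single (insert m S) 1 : Fock R) =
      field R (HahnSeries.single (-(m : ℤ)) 1) (Finsupp.single S 1) := by
  have hm : m ∉ S := fun hm => (h m hm).ne rfl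
  have hf : S.filter (fun s => m < s) = ∅ :=
    Finset.filter_eq_empty_iff.2 fun s hs => (h s hs).not_gt
  rw [field_single]
  simp [phi, phiBasis, hm, hf]

/-- The commutation rule alone forces the degree drop: build the basis vector by adding its largest
mode last, which costs no sign, and commute `F` past it. -/
theorem IsHeis.mem_fil {F : Fock R → Fock R} {τ : PowerSeries R} (hF : IsHeis F τ) {k : ℕ}
    (hk : PowerSeries.X ^ k ∣ τ) {d : ℤ} {v : Fock R} (hv : v ∈ fil R d) : F v ∈ fil R (d - k) := by
  have key (S : Finset ℕ) : F (Finsupp.single S 1) ∈ fil R (((∑ s ∈ S, s : ℕ) : ℤ) - k) := by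
    induction S using Finset.induction_on_max with
    | empty => rw [show (Finsupp.single ∅ 1 : Fock R) = NeutralFermion.vac R from rfl, hF.vac]; simp
    | insert m S hm ih =>
      rw [single_insert_eq_phi hm, hF.comm, Finset.sum_insert fun h => (hm m h).ne rfl]
      have ho : OrderGE (HahnSeries.single (-(m : ℤ)) (1 : R)) (-m) := fun n hn =>
        HahnSeries.coeff_single_of_ne hn.ne
      refine add_mem (fil_mono ?_ (field_mem_fil ho ih))
        (fil_mono ?_ (field_mem_fil (ho.lau_mul_of_dvd hk) (single_mem_fil le_rfl 1)))
      all_goals push_cast; linarith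
  exact map_mem_fil (T := IsLinearMap.mk' F hF.isLinear)
    (fun S hS => fil_mono (by omega) (key S)) hv

theorem IsHeis.smul {F : Fock R → Fock R} {τ : PowerSeries R} (hF : IsHeis F τ) (r : R) :
    IsHeis (fun v => r • F v) (r • τ) where
  isLinear := ⟨fun v w => by simp [hF.isLinear.map_add], fun s v => by
    rw [hF.isLinear.map_smul, smul_comm]⟩
  vac := by simp [hF.vac]
  comm a v := by
    rw [hF.comm, lau_smul, smul_add, map_smul, ← HahnSeries.C_mul_eq_smul, mul_assoc,
      HahnSeries.C_mul_eq_smul, map_smul, LinearMap.smul_apply]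

theorem IsHeis.rat_smul [Algebra ℚ R] {F : Fock R → Fock R} {τ : PowerSeries R} (hF : IsHeis F τ)
    (r : ℚ) : IsHeis (fun v => r • F v) (algebraMap ℚ R r • τ) := by
  simpa only [algebraMap_smul] using hF.smul (algebraMap ℚ R r)

theorem IsHeis.zero : IsHeis (fun _ : Fock R => 0) 0 where
  isLinear := ⟨by simp, by simp⟩
  vac := rfl
  comm a v := by simp

/-- The sum of a family of power series, the `j`-th of which is divisible by `X ^ j`. -/
def psSum (τ : ℕ → PowerSeries R) : PowerSeries R :=
  PowerSeries.mk fun n => ∑ j ∈ Finset.range (n + 1), PowerSeries.coeff n (τ j)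

theorem X_pow_dvd_psSum {τ : ℕ → PowerSeries R} {k : ℕ} (h : ∀ j, PowerSeries.X ^ k ∣ τ j) :
    PowerSeries.X ^ k ∣ psSum τ := by
  simp only [PowerSeries.X_pow_dvd_iff] at h ⊢
  intro m hm
  rw [psSum, PowerSeries.coeff_mk]
  exact Finset.sum_eq_zero fun j _ => h j m hm

theorem X_pow_dvd_psSum_sub {τ : ℕ → PowerSeries R} (h : ∀ j, PowerSeries.X ^ j ∣ τ j) (N : ℕ) :
    PowerSeries.X ^ N ∣ psSum τ - ∑ j ∈ Finset.range N, τ j := by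
  simp only [PowerSeries.X_pow_dvd_iff] at h ⊢
  intro m hm
  rw [map_sub, map_sum, psSum, PowerSeries.coeff_mk, sub_eq_zero]
  refine Finset.sum_subset (Finset.range_subset_range.2 hm) fun j _ hj => h j m ?_
  simpa using hj

theorem finsum_eq_sum_range {F : ℕ → Fock R → Fock R}
    (hF : ∀ (j : ℕ) (d : ℤ) (v : Fock R), v ∈ fil R d → F j v ∈ fil R (d - j))
    {d : ℤ} {v : Fock R} (hv : v ∈ fil R d) {N : ℕ} (hN : d < N) :
    ∑ᶠ j, F j v = ∑ j ∈ Finset.range N, F j v := by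
  refine finsum_eq_finsetSum_of_support_subset _ fun j hj => ?_
  by_contra h
  refine hj (fil_neg ?_ (hF j d v hv))
  simp only [Finset.coe_range, Set.mem_Iio, not_lt] at h
  omega

/-- The tail from `N` on is divisible by `X ^ N`, so its operator lowers the degree of `v` below
`0`. -/
theorem field_psSum_mul {τ : ℕ → PowerSeries R} (h : ∀ j, PowerSeries.X ^ j ∣ τ j)
    {a : LaurentSeries R} {k d : ℤ} (ha : OrderGE a k) {v : Fock R} (hv : v ∈ fil R d) {N : ℕ}
    (hN : d < k + N) :
    field R (lau R (psSum τ) * a) v = ∑ j ∈ Finset.range N, field R (lau R (τ j) * a) v := by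
  rw [← sub_add_cancel (psSum τ) (∑ j ∈ Finset.range N, τ j), map_add, add_mul, map_add,
    LinearMap.add_apply, field_eq_zero (ha.lau_mul_of_dvd (X_pow_dvd_psSum_sub h N)) hv hN, zero_add,
    map_sum, Finset.sum_mul, map_sum, LinearMap.sum_apply]

theorem IsHeis.finsum {F : ℕ → Fock R → Fock R} {τ : ℕ → PowerSeries R}
    (hF : ∀ j, IsHeis (F j) (τ j)) (h : ∀ j, PowerSeries.X ^ j ∣ τ j) :
    IsHeis (fun v => ∑ᶠ j, F j v) (psSum τ) := by
  have hl : ∀ (j : ℕ) (d : ℤ) (v : Fock R), v ∈ fil R d → F j v ∈ fil R (d - j) :=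
    fun j d v hv => (hF j).mem_fil (h j) hv
  refine ⟨⟨fun v w => ?_, fun r v => ?_⟩, by simp [(hF _).vac], fun a v => ?_⟩
  · obtain ⟨d, hd⟩ := exists_mem_fil v
    obtain ⟨e, he⟩ := exists_mem_fil w
    have hd' := fil_mono (e := (max d e : ℕ)) (by simp) hd
    have he' := fil_mono (e := (max d e : ℕ)) (by simp) he
    have hN : ((max d e : ℕ) : ℤ) < ((max d e + 1 : ℕ) : ℤ) := by push_cast; omega
    rw [finsum_eq_sum_range hl hd' hN, finsum_eq_sum_range hl he' hN,
      finsum_eq_sum_range hl (add_mem hd' he') hN, ← Finset.sum_add_distrib]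
    exact Finset.sum_congr rfl fun j _ => (hF j).isLinear.map_add v w
  · obtain ⟨d, hd⟩ := exists_mem_fil v
    have hN : ((d : ℕ) : ℤ) < ((d + 1 : ℕ) : ℤ) := by push_cast; omega
    rw [finsum_eq_sum_range hl hd hN, finsum_eq_sum_range hl (Submodule.smul_mem _ r hd) hN,
      Finset.smul_sum]
    exact Finset.sum_congr rfl fun j _ => (hF j).isLinear.map_smul r v
  · obtain ⟨d, hd⟩ := exists_mem_fil v
    obtain ⟨k, hk⟩ := exists_orderGE a
    -- One truncation serves both `v` and `field R a v`, of degrees at most `d` and `d - k`.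
    obtain ⟨N, hN⟩ : ∃ N : ℕ, d < (N : ℤ) ∧ d - k < N := ⟨(max (d : ℤ) (d - k)).toNat + 1, by omega⟩
    rw [finsum_eq_sum_range hl hd hN.1, finsum_eq_sum_range hl (field_mem_fil hk hd) hN.2,
      field_psSum_mul h hk hd (N := N) (by omega), map_sum, ← Finset.sum_add_distrib]
    exact Finset.sum_congr rfl fun j _ => (hF j).comm a v

end Heisenberg

/-! ### The Heisenberg generators, `θ` and `H^{[β]}`. -/

section Generators

variable {R : Type*} [CommRing R]

/-- For very negative `i` the inner fermion kills `v`. For large `i` the outer one does, after the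
two are exchanged, which is free of a scalar because `m ≠ 0`. -/
theorem heis_support_finite {m : ℤ} (hm : m ≠ 0) (v : Fock R) :
    (Function.support fun i : ℤ =>
      (i.negOnePow : ℤ) • phi R (-i - m) (phi R i v)).Finite := by
  obtain ⟨d, hd⟩ := exists_mem_fil v
  refine (Set.finite_Icc (-(d : ℤ)) (d - m)).subset fun i hi => ?_
  by_contra h
  apply hi
  rw [Set.mem_Icc, not_and_or, not_le, not_le] at h
  rcases h with h | h
  · simp only [fil_neg (by omega) (phi_mem_fil i hd), map_zero, smul_zero]
  · have := phi_phi (-i - m) i v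
    rw [if_neg (by omega), fil_neg (by omega) (phi_mem_fil (-i - m) hd), map_zero, zero_smul,
      add_zero] at this
    simp only [this, smul_zero]

variable [Algebra ℚ R]

theorem heis_isLinear {m : ℤ} (hm : m ≠ 0) : IsLinearMap R (heis (R := R) m) where
  map_add v w := by
    unfold heis
    rw [← smul_add, ← finsum_add_distrib (heis_support_finite hm v) (heis_support_finite hm w)]
    simp only [map_add, smul_add]
  map_smul r v := by
    unfold heis
    rw [smul_comm r, smul_finsum' r (heis_support_finite hm v)]
    simp only [map_smul, smul_comm r]

theorem heis_phi {m : ℤ} (hm : Odd m) (n : ℤ) (v : Fock R) :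
    heis m (phi R n v) = phi R n (heis m v) + phi R (n - m) v := by
  have hm0 : m ≠ 0 := by rintro rfl; simp at hm
  have hs := heis_support_finite hm0 v
  have h1 : phi R n (∑ᶠ i : ℤ, (i.negOnePow : ℤ) • phi R (-i - m) (phi R i v)) =
      ∑ᶠ i : ℤ, phi R n ((i.negOnePow : ℤ) • phi R (-i - m) (phi R i v)) :=
    (phi R n).toAddMonoidHom.map_finsum hs
  -- Moving `φ_n` left past two fermions leaves contractions at `i = -n` and `i = n - m`. As `m` is
  -- odd they add up to `4 φ_{n-m}`, which the factor `1/4` normalizes.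
  have key (i : ℤ) : (i.negOnePow : ℤ) • phi R (-i - m) (phi R i (phi R n v)) =
      phi R n ((i.negOnePow : ℤ) • phi R (-i - m) (phi R i v)) +
      ((if i + n = 0 then 2 else 0 : ℤ) • phi R (-i - m) v +
        (if i = n - m then 2 else 0 : ℤ) • phi R i v) := by
    have e1 := phi_phi i n v
    have e2 := phi_phi (-i - m) n (phi R i v)
    rw [eq_sub_of_add_eq e1, map_sub, eq_sub_of_add_eq e2, map_zsmul, map_zsmul, smul_sub, smul_sub,
      smul_smul, smul_smul]
    have c1 : (i.negOnePow : ℤ) * (if i + n = 0 then 2 * (i.negOnePow : ℤ) else 0) =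
        if i + n = 0 then 2 else 0 := by
      split_ifs
      · rw [mul_left_comm, ← Units.val_mul, Int.units_mul_self]; simp
      · simp
    have c2 : (i.negOnePow : ℤ) * (if -i - m + n = 0 then 2 * ((-i - m).negOnePow : ℤ) else 0) =
        - if i = n - m then 2 else 0 := by
      have : -i - m + n = 0 ↔ i = n - m := by omega
      simp only [this]
      split_ifs
      · rw [Int.negOnePow_sub, Int.negOnePow_odd m hm, Int.negOnePow_neg]
        have := congrArg (fun u : ℤˣ => (u : ℤ)) (Int.units_mul_self i.negOnePow)
        simp only [Units.val_mul, Units.val_one] at this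
        simp only [Units.val_mul, Units.val_neg, Units.val_one]
        linear_combination (-2) * this
      · simp
    rw [c1, c2, neg_smul]
    abel
  have hA : (Function.support fun i : ℤ =>
      (if i + n = 0 then 2 else 0 : ℤ) • phi R (-i - m) v).Finite :=
    (Set.finite_singleton (-n)).subset fun i hi => by
      by_contra h; exact hi (by simp only; rw [if_neg (fun h' => h (by simp; omega)), zero_smul])
  have hB : (Function.support fun i : ℤ => (if i = n - m then 2 else 0 : ℤ) • phi R i v).Finite :=
    (Set.finite_singleton (n - m)).subset fun i hi => by
      by_contra h; exact hi (by simp only; rw [if_neg (by simpa using h), zero_smul])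
  unfold heis
  simp only [key]
  rw [finsum_add_distrib, finsum_add_distrib hA hB, ← h1, smul_add, map_rat_smul,
    finsum_eq_single (fun i : ℤ => (if i + n = 0 then 2 else 0 : ℤ) • phi R (-i - m) v) (-n)
      fun i hi => by rw [if_neg (by omega), zero_smul],
    finsum_eq_single (fun i : ℤ => (if i = n - m then 2 else 0 : ℤ) • phi R i v) (n - m)
      fun i hi => by rw [if_neg hi, zero_smul]]
  · congr 1
    rw [if_pos (by omega), if_pos rfl, neg_neg, ← add_smul, ← Int.cast_smul_eq_zsmul ℚ, smul_smul]
    norm_num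
  · refine hs.subset fun i hi h => hi ?_
    simp only at h
    simp only [h, map_zero]
  · exact (hA.union hB).subset (Function.support_add _ _)

theorem isHeis_heis {m : ℕ} (hm : Odd m) : IsHeis (heis (R := R) m) (PowerSeries.X ^ m) := by
  have hm0 : (m : ℤ) ≠ 0 := by rintro h; simp_all
  have hm' : Odd (m : ℤ) := by exact_mod_cast hm
  refine ⟨heis_isLinear hm0, ?_, fun a v => ?_⟩
  · unfold heis
    rw [finsum_eq_zero_of_forall_eq_zero, smul_zero]
    intro i
    rw [fil_neg (by omega) (phi_mem_fil (-i - m) (phi_mem_fil i vac_mem_fil)), smul_zero]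
  · have h := map_modeSum lowering_phi (IsLinearMap.mk' _ (heis_isLinear (R := R) hm0)) a v
    simp only [IsLinearMap.mk'_apply, heis_phi hm', smul_add] at h
    rw [HahnSeries.ofPowerSeries_X_pow]
    have h2 : field R (HahnSeries.single (m : ℤ) 1 * a) v =
        ∑ᶠ n, a.coeff n • phi R (-n - m) v := by
      rw [field, modeSum_apply, ← finsum_comp_equiv (Equiv.addRight (m : ℤ))]
      simp [HahnSeries.coeff_single_mul, sub_eq_add_neg, add_comm]
    have hf : (Function.support fun n => a.coeff n • phi R (-n - m) v).Finite := by
      have := (lowering_phi.support_finite (HahnSeries.single (m : ℤ) 1 * a) v).preimage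
        (Equiv.addRight (m : ℤ)).injective.injOn
      refine this.subset fun n hn => ?_
      simpa [HahnSeries.coeff_single_mul, sub_eq_add_neg, add_comm] using hn
    rw [field, h, finsum_add_distrib (lowering_phi.support_finite a _) hf, ← h2]
    rfl

/-- The series of `θ`. -/
def thetaSeries (β : R) : PowerSeries R :=
  algebraMap ℚ R 2 • psSum fun j => ((1 / 2 : ℚ) • β) ^ (2 * j + 1) •
    algebraMap ℚ R (1 / (2 * j + 1 : ℚ)) • PowerSeries.X ^ (2 * j + 1)

theorem isHeis_theta (β : R) : IsHeis (theta β) (thetaSeries β) := by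
  refine IsHeis.rat_smul (IsHeis.finsum (fun j => IsHeis.smul (IsHeis.rat_smul ?_ _) _) fun j => ?_) _
  · exact_mod_cast isHeis_heis (R := R) (m := 2 * j + 1) (by simp)
  · simp only [← smul_assoc]
    exact (pow_dvd_pow _ (by omega)).trans (Dvd.intro_left _ (PowerSeries.smul_eq_C_mul _ _).symm)

/-- The multiplier itself is never needed: `e^{H}` enters both sides of the theorem only through the
functional `⟨0| e^{H}`. -/
theorem exists_isHeis_dheis (β : R) (m : ℕ) :
    ∃ τ : PowerSeries R, PowerSeries.X ^ m ∣ τ ∧ IsHeis (dheis β m) τ := by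
  have h (j : ℕ) : ∃ τ : PowerSeries R, PowerSeries.X ^ (m + j) ∣ τ ∧ IsHeis (fun v : Fock R =>
      if Odd (m + j) then Ring.choose (-(m : ℤ)) j • ((-1 / 2 : ℚ) • β) ^ j •
        heis ((m + j : ℕ) : ℤ) v else 0) τ := by
    by_cases hj : Odd (m + j)
    · simp only [hj, if_true, ← Int.cast_smul_eq_zsmul R]
      exact ⟨_, Dvd.intro_left _ (by
        rw [← PowerSeries.smul_eq_C_mul, ← smul_smul]), ((isHeis_heis hj).smul _).smul _⟩
    · simp only [hj, if_false]
      exact ⟨0, dvd_zero _, IsHeis.zero⟩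
  choose τ h1 h2 using h
  exact ⟨_, X_pow_dvd_psSum fun j => (pow_dvd_pow _ (by omega)).trans (h1 j),
    IsHeis.finsum h2 fun j => (pow_dvd_pow _ (by omega)).trans (h1 j)⟩

theorem exists_isHeis_dham (β : R) (p : ℕ → R) :
    ∃ τ : PowerSeries R, PowerSeries.X ∣ τ ∧ IsHeis (dham β p) τ := by
  choose τ h1 h2 using exists_isHeis_dheis β
  have h3 (m : ℕ) : PowerSeries.X ^ (m + 1) ∣
      algebraMap ℚ R (1 / (m + 1 : ℚ)) • p (m + 1) • τ (m + 1) := by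
    rw [smul_smul, PowerSeries.smul_eq_C_mul]; exact (h1 _).mul_left _
  refine ⟨_, ?_, IsHeis.rat_smul (IsHeis.finsum
    (fun m => ((h2 (m + 1)).smul (p (m + 1))).rat_smul _)
    fun m => (pow_dvd_pow _ (by omega)).trans (h3 m)) 2⟩
  rw [PowerSeries.smul_eq_C_mul]
  refine Dvd.dvd.mul_left ?_ _
  simpa using X_pow_dvd_psSum (k := 1) fun m => (pow_dvd_pow _ (by omega)).trans (h3 m)

end Generators

/-! ### Exponentials of Heisenberg operators; the multiplier of `e^{-θ}`. -/

section Exponential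

variable {R : Type*} [CommRing R]

theorem IsHeis.iterate_field {F : Fock R → Fock R} {τ : PowerSeries R} (hF : IsHeis F τ)
    (n : ℕ) (a : LaurentSeries R) (v : Fock R) :
    F^[n] (field R a v) = ∑ ij ∈ Finset.HasAntidiagonal.antidiagonal n,
      n.choose ij.1 • field R (lau R (τ ^ ij.1) * a) (F^[ij.2] v) := by
  induction n with
  | zero => simp
  | succ n ih =>
    rw [Function.iterate_succ_apply', ih,
      Finset.sum_antidiagonal_choose_succ_nsmul
        (fun i j => field R (lau R (τ ^ i) * a) (F^[j] v)) n, ← Finset.sum_add_distrib,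
      ← IsLinearMap.mk'_apply hF.isLinear, map_sum]
    refine Finset.sum_congr rfl fun ij hij => ?_
    have hc : n.choose ij.2 = n.choose ij.1 :=
      Nat.choose_symm_of_eq_add (by rw [← Finset.HasAntidiagonal.mem_antidiagonal.1 hij, add_comm])
    rw [map_nsmul, IsLinearMap.mk'_apply, hF.comm, smul_add, hc, Function.iterate_succ_apply',
      ← mul_assoc, ← map_mul, ← pow_succ']

theorem IsHeis.iterate_isLinear {F : Fock R → Fock R} {τ : PowerSeries R} (hF : IsHeis F τ)
    (n : ℕ) : IsLinearMap R F^[n] := by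
  induction n with
  | zero => exact ⟨by simp, by simp⟩
  | succ n ih =>
    exact ⟨fun v w => by simp only [Function.iterate_succ_apply', ih.map_add, hF.isLinear.map_add],
      fun r v => by simp only [Function.iterate_succ_apply', ih.map_smul, hF.isLinear.map_smul]⟩

theorem IsHeis.iterate_mem_fil {F : Fock R → Fock R} {τ : PowerSeries R} (hF : IsHeis F τ)
    (hτ : PowerSeries.X ∣ τ) (n : ℕ) {d : ℤ} {v : Fock R} (hv : v ∈ fil R d) :
    F^[n] v ∈ fil R (d - n) := by
  induction n with
  | zero => simpa using hv
  | succ n ih =>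
    rw [Function.iterate_succ_apply']
    exact fil_mono (by push_cast; omega) (hF.mem_fil (k := 1) (by simpa using hτ) ih)

variable [Algebra ℚ R]

/-- The exponential of a locally nilpotent operator. -/
def expOp (F : Fock R → Fock R) (v : Fock R) : Fock R :=
  ∑ᶠ k : ℕ, (1 / (k.factorial : ℚ)) • F^[k] v

/-- The exponential of a power series without constant term. -/
def psExp (τ : PowerSeries R) : PowerSeries R :=
  psSum fun k => algebraMap ℚ R (1 / (k.factorial : ℚ)) • τ ^ k

theorem IsHeis.expOp_eq_sum {F : Fock R → Fock R} {τ : PowerSeries R} (hF : IsHeis F τ)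
    (hτ : PowerSeries.X ∣ τ) {d : ℤ} {v : Fock R} (hv : v ∈ fil R d) {N : ℕ} (hN : d < N) :
    expOp F v = ∑ k ∈ Finset.range N, (1 / (k.factorial : ℚ)) • F^[k] v := by
  refine finsum_eq_sum_range (F := fun k v => (1 / (k.factorial : ℚ)) • F^[k] v)
    (fun j d v hv => ?_) hv hN
  simp only [← algebraMap_smul R (1 / (j.factorial : ℚ))]
  exact Submodule.smul_mem _ _ (hF.iterate_mem_fil hτ j hv)

theorem IsHeis.expOp_isLinear {F : Fock R → Fock R} {τ : PowerSeries R} (hF : IsHeis F τ)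
    (hτ : PowerSeries.X ∣ τ) : IsLinearMap R (expOp F) where
  map_add v w := by
    obtain ⟨d, hd⟩ := exists_mem_fil v
    obtain ⟨e, he⟩ := exists_mem_fil w
    have hd' := fil_mono (e := (max d e : ℕ)) (by simp) hd
    have he' := fil_mono (e := (max d e : ℕ)) (by simp) he
    have hN : ((max d e : ℕ) : ℤ) < ((max d e + 1 : ℕ) : ℤ) := by push_cast; omega
    rw [hF.expOp_eq_sum hτ hd' hN, hF.expOp_eq_sum hτ he' hN,
      hF.expOp_eq_sum hτ (add_mem hd' he') hN, ← Finset.sum_add_distrib]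
    simp only [(hF.iterate_isLinear _).map_add, smul_add]
  map_smul r v := by
    obtain ⟨d, hd⟩ := exists_mem_fil v
    have hN : ((d : ℕ) : ℤ) < ((d + 1 : ℕ) : ℤ) := by push_cast; omega
    rw [hF.expOp_eq_sum hτ hd hN, hF.expOp_eq_sum hτ (Submodule.smul_mem _ r hd) hN,
      Finset.smul_sum]
    simp only [(hF.iterate_isLinear _).map_smul, smul_comm r]

theorem IsHeis.expOp_vac {F : Fock R → Fock R} {τ : PowerSeries R} (hF : IsHeis F τ)
    (hτ : PowerSeries.X ∣ τ) : expOp F (NeutralFermion.vac R) = NeutralFermion.vac R := by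
  rw [hF.expOp_eq_sum hτ vac_mem_fil (N := 1) (by simp)]
  simp

theorem X_pow_dvd_psExp_term {τ : PowerSeries R} (hτ : PowerSeries.X ∣ τ) (k : ℕ) :
    PowerSeries.X ^ k ∣ algebraMap ℚ R (1 / (k.factorial : ℚ)) • τ ^ k := by
  rw [PowerSeries.smul_eq_C_mul]
  exact (pow_dvd_pow_of_dvd hτ k).mul_left _

theorem sum_range_antidiagonal {M : Type*} [AddCommMonoid M] (T : ℕ → ℕ → M) (N : ℕ)
    (hT : ∀ i j, N ≤ i + j → T i j = 0) :
    ∑ n ∈ Finset.range N, ∑ ij ∈ Finset.HasAntidiagonal.antidiagonal n, T ij.1 ij.2 =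
      ∑ i ∈ Finset.range N, ∑ j ∈ Finset.range N, T i j := by
  simp only [Finset.Nat.sum_antidiagonal_eq_sum_range_succ T]
  rw [Finset.sum_range_diag_flip N T]
  refine Finset.sum_congr rfl fun i hi => ?_
  refine Finset.sum_subset (Finset.range_subset_range.2 (by omega)) fun j _ hj => hT i j ?_
  simp only [Finset.mem_range] at hj hi
  omega

/-- Leibniz's rule for `F^n` turns the exponential series into a Cauchy product of the exponentials
on `a` and on `v`. -/
theorem IsHeis.expOp_field {F : Fock R → Fock R} {τ : PowerSeries R} (hF : IsHeis F τ)
    (hτ : PowerSeries.X ∣ τ) (a : LaurentSeries R) (v : Fock R) :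
    expOp F (field R a v) = field R (lau R (psExp τ) * a) (expOp F v) := by
  obtain ⟨d, hd⟩ := exists_mem_fil v
  obtain ⟨k, hk⟩ := exists_orderGE a
  obtain ⟨N, hN⟩ : ∃ N : ℕ, d < (N : ℤ) ∧ d - k < N := ⟨(max (d : ℤ) (d - k)).toNat + 1, by omega⟩
  rw [hF.expOp_eq_sum hτ hd hN.1, hF.expOp_eq_sum hτ (field_mem_fil hk hd) hN.2, map_sum]
  let T (i j : ℕ) : Fock R := field R (lau R (algebraMap ℚ R (1 / (i.factorial : ℚ)) • τ ^ i) * a)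
    ((1 / (j.factorial : ℚ)) • F^[j] v)
  -- Beyond the triangle `i + j < N` the degree is negative, so the triangle may be completed to a
  -- square.
  have hT (i j : ℕ) (h : N ≤ i + j) : T i j = 0 := by
    refine field_eq_zero (hk.lau_mul_of_dvd (X_pow_dvd_psExp_term hτ i)) (d := d - j) ?_ (by omega)
    rw [← algebraMap_smul R (1 / (j.factorial : ℚ))]
    exact Submodule.smul_mem _ _ (hF.iterate_mem_fil hτ j hd)
  trans ∑ n ∈ Finset.range N, ∑ ij ∈ Finset.HasAntidiagonal.antidiagonal n, T ij.1 ij.2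
  · refine Finset.sum_congr rfl fun n _ => ?_
    rw [hF.iterate_field, Finset.smul_sum]
    refine Finset.sum_congr rfl fun ij hij => ?_
    obtain rfl := Finset.HasAntidiagonal.mem_antidiagonal.1 hij
    simp only [T]
    rw [lau_smul, ← HahnSeries.C_mul_eq_smul, mul_assoc, HahnSeries.C_mul_eq_smul, map_rat_smul,
      (field R).map_smul, LinearMap.smul_apply, algebraMap_smul, smul_smul, ← Nat.cast_smul_eq_nsmul ℚ,
      smul_smul, Nat.cast_add_choose]
    congr 1
    have h1 := Nat.cast_ne_zero (R := ℚ).2 (Nat.factorial_ne_zero ij.1)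
    have h2 := Nat.cast_ne_zero (R := ℚ).2 (Nat.factorial_ne_zero ij.2)
    have h3 := Nat.cast_ne_zero (R := ℚ).2 (Nat.factorial_ne_zero (ij.1 + ij.2))
    field_simp
  · rw [sum_range_antidiagonal T N hT, Finset.sum_comm]
    refine Finset.sum_congr rfl fun j _ => ?_
    refine (field_psSum_mul (X_pow_dvd_psExp_term hτ) hk (d := d) (N := N) ?_ (by omega)).symm
    rw [← algebraMap_smul R (1 / (j.factorial : ℚ))]
    exact Submodule.smul_mem _ _ (fil_mono (by omega) (hF.iterate_mem_fil hτ j hd))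

open PowerSeries in
theorem derivative_psExp {τ : PowerSeries R} (hτ : X ∣ τ) :
    d⁄dX R (psExp τ) = d⁄dX R τ * psExp τ := by
  have hs (N : ℕ) : d⁄dX R (∑ k ∈ Finset.range (N + 1), algebraMap ℚ R (1 / (k.factorial : ℚ)) • τ ^ k)
      = d⁄dX R τ * ∑ k ∈ Finset.range N, algebraMap ℚ R (1 / (k.factorial : ℚ)) • τ ^ k := by
    rw [Finset.sum_range_succ', map_add, map_sum, Finset.mul_sum]
    have h0 : d⁄dX R (algebraMap ℚ R (1 / (Nat.factorial 0 : ℚ)) • τ ^ 0) = 0 := by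
      rw [Derivation.map_smul, pow_zero, derivative_one, smul_zero]
    rw [h0, add_zero]
    refine Finset.sum_congr rfl fun k _ => ?_
    rw [Derivation.map_smul, derivative_pow]
    simp only [smul_eq_C_mul]
    have : (C (algebraMap ℚ R (1 / ((k + 1).factorial : ℚ))) : PowerSeries R) * ((k + 1 : ℕ) : PowerSeries R)
        = C (algebraMap ℚ R (1 / (k.factorial : ℚ))) := by
      rw [← map_natCast (C : R →+* PowerSeries R), ← map_mul, ← map_natCast (algebraMap ℚ R), ← map_mul]
      congr 2
      have h2 := Nat.cast_ne_zero (R := ℚ).2 (Nat.factorial_ne_zero k)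
      rw [Nat.factorial_succ]; push_cast; field_simp
    rw [← this, Nat.add_sub_cancel]; ring
  have hd {f : PowerSeries R} {N : ℕ} (h : X ^ (N + 1) ∣ f) : X ^ N ∣ d⁄dX R f := by
    rw [X_pow_dvd_iff] at h ⊢
    intro m hm
    rw [coeff_derivative, h _ (by omega), zero_mul]
  rw [← sub_eq_zero]
  ext n
  rw [map_zero]
  -- One more term on the differentiated side, since a derivative costs one power of `X`.
  have h1 := hd (X_pow_dvd_psSum_sub (X_pow_dvd_psExp_term hτ) (n + 1 + 1))
  have h2 := (X_pow_dvd_psSum_sub (X_pow_dvd_psExp_term hτ) (n + 1)).mul_left (d⁄dX R τ)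
  have h3 := dvd_sub h1 h2
  rw [map_sub, hs, mul_sub, sub_sub_sub_cancel_right, X_pow_dvd_iff] at h3
  exact h3 n (by omega)

open PowerSeries in
theorem constantCoeff_psExp (τ : PowerSeries R) : constantCoeff (psExp τ) = 1 := by
  rw [← coeff_zero_eq_constantCoeff_apply, psExp, psSum, coeff_mk]
  simp

open PowerSeries in
theorem X_dvd_thetaSeries (β : R) : X ∣ thetaSeries β := by
  rw [thetaSeries, smul_eq_C_mul]
  refine Dvd.dvd.mul_left ?_ _
  have := X_pow_dvd_psSum (k := 1) (τ := fun j : ℕ => ((1 / 2 : ℚ) • β) ^ (2 * j + 1) •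
    algebraMap ℚ R (1 / (2 * j + 1 : ℚ)) • (X : PowerSeries R) ^ (2 * j + 1)) fun j => by
      rw [smul_smul, smul_eq_C_mul]; exact (pow_dvd_pow _ (by omega)).mul_left _
  simpa using this

open PowerSeries in
theorem coeff_thetaSeries (β : R) (n : ℕ) : coeff n (thetaSeries β) =
    if Odd n then ((1 / 2 : ℚ) • β) ^ n * algebraMap ℚ R (2 / n) else 0 := by
  simp only [thetaSeries, map_smul, psSum, coeff_mk, coeff_X_pow, smul_eq_mul]
  split_ifs with h
  · obtain ⟨j, rfl⟩ := h
    rw [Finset.sum_eq_single j]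
    · rw [if_pos rfl, mul_one, mul_left_comm, ← map_mul]; congr 2; push_cast; ring
    · intro i _ hi; rw [if_neg (by omega)]; simp
    · intro hj; simp at hj; omega
  · rw [Finset.sum_eq_zero, mul_zero]
    intro j _
    rw [if_neg (fun h' => h ⟨j, h'⟩)]; simp

-- The series is `2 artanh(βt/2)`, with derivative `β / (1 - β²t²/4)`.
open PowerSeries in
theorem derivative_thetaSeries (β : R) :
    (1 - C (((1 / 2 : ℚ) • β) ^ 2) * X ^ 2) * d⁄dX R (thetaSeries β) = C β := by
  set h := (1 / 2 : ℚ) • β with hh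
  have hc (n : ℕ) : coeff n (d⁄dX R (thetaSeries β)) = if Even n then h ^ (n + 1) * 2 else 0 := by
    rw [coeff_derivative, coeff_thetaSeries]
    simp only [Nat.odd_add_one, Nat.not_odd_iff_even]
    split_ifs
    · rw [mul_assoc, show (n : R) + 1 = ((n + 1 : ℕ) : R) by push_cast; rfl, ← map_natCast (algebraMap ℚ R), ← map_mul,
        div_mul_cancel₀ _ (by positivity), map_ofNat]
    · simp
  have h2 : h * 2 = β := by
    rw [hh, smul_mul_assoc, mul_two, smul_add, ← add_smul]; norm_num
  ext n
  rw [sub_mul, one_mul, map_sub, mul_assoc, coeff_C_mul, coeff_X_pow_mul', hc, coeff_C]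
  rcases n with _ | _ | n
  · simp [h2]
  · simp
  · rw [if_pos (show 2 ≤ n + 1 + 1 by omega), show n + 1 + 1 - 2 = n by omega, hc]
    rw [if_neg (show ¬ n + 1 + 1 = 0 by omega)]
    by_cases he : Even n
    · rw [if_pos he, if_pos (by simpa [Nat.even_add_one] using he)]; ring
    · rw [if_neg he, if_neg (by simpa [Nat.even_add_one] using he)]; simp

open PowerSeries in
/-- `exp(-θ)` acts as `(1 - β t / 2) / (1 + β t / 2)`. -/
theorem psExp_neg_thetaSeries (β : R) :
    psExp (-thetaSeries β) * (1 + C ((1 / 2 : ℚ) • β) * X) = 1 - C ((1 / 2 : ℚ) • β) * X := by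
  set h := (1 / 2 : ℚ) • β with hh
  have h2 : β = 2 * h := by
    rw [hh, mul_smul_comm, two_mul, smul_add, ← add_smul]; norm_num
  have hP : IsUnit (1 - C h * X : PowerSeries R) := by rw [isUnit_iff_constantCoeff]; simp
  have hQ : IsUnit (1 + C h * X : PowerSeries R) := by rw [isUnit_iff_constantCoeff]; simp
  have hE := derivative_psExp (τ := -thetaSeries β) ((X_dvd_thetaSeries β).neg_right)
  have hτ := derivative_thetaSeries β
  rw [← hh] at hτ
  have hE0 := constantCoeff_psExp (-thetaSeries β)
  set E := psExp (-thetaSeries β)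
  rw [map_neg] at hE
  set D := d⁄dX R (thetaSeries β)
  rw [h2, map_mul, map_pow] at hτ
  simp only [map_ofNat] at hτ
  obtain ⟨P', hP'⟩ := hP.exists_right_inv
  have dP : d⁄dX R (1 - C h * X) = - C h := by
    rw [map_sub, derivative_one, Derivation.leibniz, derivative_C, derivative_X]; simp
  have dQ : d⁄dX R (1 + C h * X) = C h := by
    rw [map_add, derivative_one, Derivation.leibniz, derivative_C, derivative_X]; simp
  have dP' := congrArg (d⁄dX R) hP'
  rw [Derivation.leibniz, dP, derivative_one, smul_eq_mul, smul_eq_mul] at dP'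
  -- The quotient of the two sides, `E (1 + ht)/(1 - ht)`, has derivative zero and constant term
  -- `1`, so it is `1` over a `ℚ`-algebra.
  have hconst : d⁄dX R (E * (1 + C h * X) * P') = d⁄dX R 1 := by
    rw [derivative_one, Derivation.leibniz, Derivation.leibniz, dQ, hE]
    simp only [smul_eq_mul]
    have hu := (hP.pow 2).mul hQ
    rw [← hu.mul_right_eq_zero]
    linear_combination (E * (1 + C h * X) ^ 2 * (1 - C h * X)) * dP' -
      E * P' * (1 - C h * X) * (1 + C h * X) * hτ
  have := IsAddTorsionFree.of_module_rat R
  have := derivative.ext hconst (by simp [hE0, show constantCoeff P' = 1 by simpa using congrArg constantCoeff hP'])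
  calc _ = E * (1 + C h * X) * P' * (1 - C h * X) := by rw [mul_assoc _ P', mul_comm P', hP', mul_one]
    _ = _ := by rw [this, one_mul]

end Exponential

/-! ### The series of `φ^{[β]}_n` and the binomial expansion of powers of the multiplier. -/

section Dual

variable {R : Type*} [CommRing R] [Algebra ℚ R]

/-- The one-particle vector of `φ^{[β]}_n`. -/
def dualVec (β : R) (n : ℤ) : LaurentSeries R :=
  HahnSeries.ofSuppBddBelow
    (fun m => if -n ≤ m then
      ((Ring.choose m (m + n).toNat : ℤ) : R) * ((1 / 2 : ℚ) • β) ^ (m + n).toNat else 0)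
    ⟨-n, fun m hm => by by_contra h; exact hm (if_neg h)⟩

theorem coeff_dualVec (β : R) (n m : ℤ) : (dualVec β n).coeff m = if -n ≤ m then
    ((Ring.choose m (m + n).toNat : ℤ) : R) * ((1 / 2 : ℚ) • β) ^ (m + n).toNat else 0 := rfl

theorem orderGE_dualVec (β : R) (n : ℤ) : OrderGE (dualVec β n) (-n) := fun m hm => by
  rw [coeff_dualVec, if_neg (by omega)]

theorem dbphi_eq_field (β : R) (n : ℤ) (v : Fock R) : dbphi β n v = field R (dualVec β n) v := by
  have hu (k : ℤ) : (((k.negOnePow : ℤˣ) : ℤ) : R) * ((k.negOnePow : ℤˣ) : ℤ) = 1 := by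
    rw [← Int.cast_mul, ← Units.val_mul, Int.units_mul_self]; simp
  -- The sign of `*`, that of `(-β)^{m+n}` and the prefactor `(-1)^n` cancel.
  have hc (m : ℤ) : bphiCoeff (-β) (-n) m * ((m.negOnePow : ℤ) : R) =
      ((n.negOnePow : ℤ) : R) * (dualVec β n).coeff m := by
    rw [bphiCoeff, coeff_dualVec]
    split_ifs with h
    · obtain ⟨l, hl⟩ := Int.eq_ofNat_of_zero_le (show 0 ≤ m + n by omega)
      have hm : (m.negOnePow : ℤ) = n.negOnePow * (-1) ^ l := by
        rw [show m = l - n by omega, Int.negOnePow_sub, mul_comm]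
        simp [Int.negOnePow_def]
      rw [sub_neg_eq_add, hl, hm, smul_neg, neg_pow]
      simp only [Int.toNat_natCast, zsmul_eq_mul]
      push_cast
      have : ((-1 : R) ^ l) * (-1) ^ l = 1 := by rw [← mul_pow]; simp
      linear_combination ((n.negOnePow : ℤ) : R) * ((Ring.choose m l : ℤ) : R) * ((1 / 2 : ℚ) • β) ^ l * this
    · simp
  rw [dbphi, field, modeSum_apply]
  simp only [← Int.cast_smul_eq_zsmul R, smul_smul, hc]
  simp only [mul_smul]
  rw [← smul_finsum' _ (lowering_phi.support_finite _ _), smul_smul, hu, one_smul]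

-- In closed form the series is `t^{-n} (1 - βt/2)^{n-1}`; on coefficients the relation is Pascal's
-- rule.
open PowerSeries in
theorem mul_dualVec (β : R) (n : ℤ) :
    lau R (1 - C ((1 / 2 : ℚ) • β) * X) * dualVec β n = lau R X * dualVec β (n + 1) := by
  ext m
  rw [map_sub, map_one, map_mul, HahnSeries.ofPowerSeries_X, HahnSeries.ofPowerSeries_C, sub_mul,
    one_mul, mul_assoc, HahnSeries.C_mul_eq_smul, HahnSeries.coeff_sub, HahnSeries.coeff_smul,
    HahnSeries.coeff_single_mul, HahnSeries.coeff_single_mul, one_mul, one_mul]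
  simp only [coeff_dualVec, smul_eq_mul]
  rcases lt_trichotomy (m + n) 0 with h | h | h
  · rw [if_neg (by omega), if_neg (by omega), if_neg (by omega)]; simp
  · rw [if_pos (by omega), if_neg (by omega), if_pos (by omega)]
    simp [h, show m - 1 + (n + 1) = 0 by omega]
  · obtain ⟨l, hl⟩ := Int.eq_ofNat_of_zero_le (show 0 ≤ m + n - 1 by omega)
    rw [if_pos (by omega), if_pos (by omega), if_pos (by omega),
      show (m + n).toNat = l + 1 by omega, show (m - 1 + n).toNat = l by omega,
      show (m - 1 + (n + 1)).toNat = l + 1 by omega]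
    have := Ring.choose_succ_succ (m - 1) l
    rw [sub_add_cancel] at this
    rw [this]
    push_cast
    ring

theorem exists_shiftSeries (β : R) : ∃ q : PowerSeries R,
    (1 - PowerSeries.C ((1 / 2 : ℚ) • β) * PowerSeries.X) * q = PowerSeries.X := by
  have hP : IsUnit (1 - PowerSeries.C ((1 / 2 : ℚ) • β) * PowerSeries.X) := by
    rw [PowerSeries.isUnit_iff_constantCoeff]; simp
  obtain ⟨P', hP'⟩ := hP.exists_right_inv
  exact ⟨P' * PowerSeries.X, by rw [← mul_assoc, hP', one_mul]⟩

/-- The power series `q = t / (1 - β t / 2)`, by which the vectors of the `φ^{[β]}_n` differ. -/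
def shiftSeries (β : R) : PowerSeries R := (exists_shiftSeries β).choose

theorem mul_shiftSeries (β : R) :
    (1 - PowerSeries.C ((1 / 2 : ℚ) • β) * PowerSeries.X) * shiftSeries β = PowerSeries.X :=
  (exists_shiftSeries β).choose_spec

theorem shiftSeries_mul_dualVec (β : R) (n : ℤ) :
    lau R (shiftSeries β) * dualVec β n = dualVec β (n - 1) := by
  have hP : IsUnit (1 - PowerSeries.C ((1 / 2 : ℚ) • β) * PowerSeries.X) := by
    rw [PowerSeries.isUnit_iff_constantCoeff]; simp
  apply (hP.map (lau R)).mul_left_cancel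
  rw [mul_dualVec, ← mul_assoc, ← map_mul, mul_shiftSeries, sub_add_cancel]

theorem shiftSeries_pow_mul_dualVec (β : R) (n : ℤ) (k : ℕ) :
    lau R (shiftSeries β ^ k) * dualVec β n = dualVec β (n - k) := by
  induction k with
  | zero => simp
  | succ k ih =>
    rw [pow_succ', map_mul, mul_assoc, ih, shiftSeries_mul_dualVec]
    congr 1; push_cast; ring

/-- The multiplier of `e^{-θ}`. -/
def thetaMul (β : R) : PowerSeries R := psExp (-thetaSeries β)

/-- Indeed `1 + βq = (1 + βt/2)/(1 - βt/2)`, the inverse of the multiplier. -/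
theorem thetaMul_mul (β : R) :
    thetaMul β * (1 + PowerSeries.C β * shiftSeries β) = 1 := by
  have hP : IsUnit (1 - PowerSeries.C ((1 / 2 : ℚ) • β) * PowerSeries.X) := by
    rw [PowerSeries.isUnit_iff_constantCoeff]; simp
  apply hP.mul_left_cancel
  have h1 := psExp_neg_thetaSeries β
  have h2 := mul_shiftSeries β
  rw [← thetaMul] at h1
  have h3 : (PowerSeries.C β : PowerSeries R) = 2 * PowerSeries.C ((1 / 2 : ℚ) • β) := by
    rw [← map_ofNat PowerSeries.C 2, ← map_mul, mul_smul_comm, two_mul, smul_add, ← add_smul]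
    norm_num
  linear_combination thetaMul β * PowerSeries.C β * h2 + h1 + thetaMul β * PowerSeries.X * h3

/-- The truncated binomial expansion of `(1 + β q)^{-m}`. -/
theorem exists_thetaMul_pow (β : R) (N m : ℕ) : ∃ f : PowerSeries R, thetaMul β ^ m =
    ∑ k ∈ Finset.range (N + 1), PowerSeries.C (β ^ k * (Ring.choose (-(m : ℤ)) k : ℤ)) *
      shiftSeries β ^ k + shiftSeries β ^ (N + 1) * f := by
  have hT := thetaMul_mul β
  set c := thetaMul β
  set q := shiftSeries β
  induction m with
  | zero =>
    refine ⟨0, ?_⟩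
    rw [Finset.sum_range_succ']
    simp [Ring.choose_zero_succ]
  | succ m ih =>
    obtain ⟨f, hf⟩ := ih
    -- Pascal's rule: multiplying by `1 + βq` raises the exponent `-(m+1)` to `-m`, up to one
    -- boundary term that goes into the remainder.
    have key : ∀ n : ℕ, (1 + PowerSeries.C β * q) * ∑ k ∈ Finset.range (n + 1),
        PowerSeries.C (β ^ k * (Ring.choose (-((m + 1 : ℕ) : ℤ)) k : ℤ)) * q ^ k =
        ∑ k ∈ Finset.range (n + 1), PowerSeries.C (β ^ k * (Ring.choose (-(m : ℤ)) k : ℤ)) * q ^ k +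
        PowerSeries.C (β ^ (n + 1) * (Ring.choose (-((m + 1 : ℕ) : ℤ)) n : ℤ)) * q ^ (n + 1) := by
      intro n
      induction n with
      | zero => simp
      | succ n ih =>
        rw [Finset.sum_range_succ, mul_add, ih, Finset.sum_range_succ _ (n + 1)]
        have h := Ring.choose_succ_succ (-((m + 1 : ℕ) : ℤ)) n
        rw [show -((m + 1 : ℕ) : ℤ) + 1 = -m by push_cast; ring] at h
        rw [h]
        push_cast
        simp only [map_mul, map_add, map_pow]
        ring
    refine ⟨c * (f - PowerSeries.C (β ^ (N + 1) * (Ring.choose (-((m + 1 : ℕ) : ℤ)) N : ℤ))), ?_⟩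
    rw [pow_succ, hf]
    have h := key N
    linear_combination (-c) * h + (∑ k ∈ Finset.range (N + 1),
        PowerSeries.C (β ^ k * (Ring.choose (-((m + 1 : ℕ) : ℤ)) k : ℤ)) * q ^ k) * hT

/-- The one-particle vector of `φ^{[β]}_n` after `i` passes of `e^{-θ}`. -/
def twistVec (β : R) (i : ℕ) (n : ℤ) : LaurentSeries R := lau R (thetaMul β ^ i) * dualVec β n

theorem orderGE_twistVec (β : R) (i : ℕ) (n : ℤ) : OrderGE (twistVec β i n) (-n) :=
  (orderGE_dualVec β n).lau_mul _

/-- The remainder starts so late that, for `N` large, its operator kills any given vector; the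
expansion is then exact. -/
theorem twistVec_add (β : R) (i m N : ℕ) (a : ℤ) : ∃ r, OrderGE r (N + 1 - a) ∧
    twistVec β (i + m) a = ∑ k ∈ Finset.range (N + 1),
      (β ^ k * ((Ring.choose (-(m : ℤ)) k : ℤ) : R)) • twistVec β i (a - k) + r := by
  obtain ⟨f, hf⟩ := exists_thetaMul_pow β N m
  refine ⟨lau R (thetaMul β ^ i * f) * dualVec β (a - (N + 1 : ℕ)), ?_, ?_⟩
  · refine OrderGE.lau_mul (OrderGE.mono (orderGE_dualVec _ _) ?_) _
    push_cast; omega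
  · rw [twistVec, pow_add, hf, ← shiftSeries_pow_mul_dualVec, mul_add, map_add, add_mul,
      Finset.mul_sum, map_sum, Finset.sum_mul]
    congr 1
    · refine Finset.sum_congr rfl fun k _ => ?_
      rw [twistVec, ← shiftSeries_pow_mul_dualVec, ← HahnSeries.C_mul_eq_smul,
        ← HahnSeries.ofPowerSeries_C]
      simp only [map_mul, mul_assoc, mul_left_comm]
    · simp only [map_mul, mul_assoc, mul_left_comm]

/-- The series starts at `t^0` and the vacuum sees nothing of positive order, so only the constant
term `1` of the multiplier counts. -/
theorem field_twistVec_zero_vac (β : R) (i j : ℕ) :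
    field R (twistVec β i 0) (vac R) = field R (twistVec β j 0) (vac R) := by
  rw [← sub_eq_zero, ← LinearMap.sub_apply, ← map_sub (field R), twistVec, twistVec,
    ← sub_mul, ← map_sub (lau R)]
  refine field_eq_zero (k := 1) ?_ vac_mem_fil (by omega)
  have := (orderGE_dualVec β 0).lau_mul_of_dvd (f := thetaMul β ^ i - thetaMul β ^ j) (m := 1) (by
    rw [pow_one, PowerSeries.X_dvd_iff]
    simp [thetaMul, constantCoeff_psExp])
  simpa using this

end Dual

/-! ### The vectors and the functional that define `o`. -/

section Kets

variable {R : Type*} [CommRing R]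

theorem ket_smul (s : ℕ → R) (n : ℕ) (f : ℕ → LaurentSeries R) :
    ket (fun i => s i • f i) n = (∏ i ∈ Finset.range n, s i) • ket f n := by
  induction n generalizing s f with
  | zero => simp [ket]
  | succ n ih =>
    rw [ket, ih (fun i => s (i + 1)) fun i => f (i + 1), ket, Finset.prod_range_succ', map_smul,
      map_smul, LinearMap.smul_apply, smul_smul, mul_comm]

variable [Algebra ℚ R]

theorem isHeis_neg_theta (β : R) : IsHeis (fun v => -theta β v) (-thetaSeries β) := by
  simpa using (isHeis_theta β).smul (-1)

theorem expNegTheta_eq_expOp (β : R) : expNegTheta β = expOp fun v => -theta β v := by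
  have h (k : ℕ) (v : Fock R) : (fun v => -theta β v)^[k] v = (-1 : ℚ) ^ k • (theta β)^[k] v := by
    induction k with
    | zero => simp
    | succ k ih =>
      rw [Function.iterate_succ_apply', Function.iterate_succ_apply', ih,
        ← IsLinearMap.mk'_apply (isHeis_theta β).isLinear, map_rat_smul, pow_succ, mul_smul,
        neg_one_smul, smul_neg]
      rfl
  funext v
  unfold expNegTheta expOp
  refine finsum_congr fun k => ?_
  rw [h, smul_smul]
  congr 1
  ring

theorem expOp_ket {F : Fock R → Fock R} {τ : PowerSeries R} (hF : IsHeis F τ)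
    (hτ : PowerSeries.X ∣ τ) (n : ℕ) (f : ℕ → LaurentSeries R) :
    expOp F (ket f n) = ket (fun i => lau R (psExp τ) * f i) n := by
  induction n generalizing f with
  | zero => exact hF.expOp_vac hτ
  | succ n ih => rw [ket, hF.expOp_field hτ, ih, ket]

/-- Each `e^{-θ}` acts on all the factors to its right, so the factor of index `i`, counted from
`0`, meets `i + 1` of them. -/
theorem gket_eq_ket (β : R) (l : List ℤ) :
    gket β l = ket (fun i => twistVec β (i + 1) (l.getD i 0)) l.length := by
  induction l with
  | nil => rfl
  | cons n l ih =>
    have hX := (X_dvd_thetaSeries β).neg_right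
    rw [gket, ih, dbphi_eq_field, expNegTheta_eq_expOp, (isHeis_neg_theta β).expOp_field hX,
      expOp_ket (isHeis_neg_theta β) hX, List.length_cons, ket, ← thetaMul]
    congr 2
    · simp [twistVec]
    · funext i
      rw [twistVec, twistVec, ← mul_assoc, ← map_mul, ← pow_succ', List.getD_cons_succ]

/-- The functional `⟨0| e^{H^{[β]}}`. -/
def covac (β : R) (p : ℕ → R) : Fock R →ₗ[R] R :=
  vev R ∘ₗ IsLinearMap.mk' (expDham β p) (by
    obtain ⟨τ, hX, hτ⟩ := exists_isHeis_dham β p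
    exact hτ.expOp_isLinear hX)

theorem covac_apply (β : R) (p : ℕ → R) (v : Fock R) : covac β p v = vev R (expDham β p v) := rfl

theorem covac_ket (β : R) (p : ℕ → R) (s : ℕ) (f : ℕ → LaurentSeries R) :
    covac β p (ket f (2 * s)) = pfaffian s fun i k =>
      covac β p (field R (f (i - 1)) (field R (f (k - 1)) (vac R))) := by
  obtain ⟨τ, hX, hτ⟩ := exists_isHeis_dham β p
  have he : expDham β p = expOp (dham β p) := rfl
  simp only [covac_apply, he]
  rw [expOp_ket hτ hX, vev_ket_eq_pfaffian]
  simp only [hτ.expOp_field hX, hτ.expOp_vac hX, pair]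

theorem oSeq_eq (β : R) (p : ℕ → R) (l : List ℤ) :
    oSeq β p l = (1 / 2 : ℚ) ^ l.length • covac β p
      (ket (fun i => twistVec β (i + 1) (l.getD i 0)) (2 * ((l.length + 1) / 2))) := by
  rw [oSeq, covac_apply]
  congr 3
  split_ifs with h
  · obtain ⟨k, hk⟩ := h
    rw [gket_eq_ket]
    congr 1; omega
  · rw [Nat.not_even_iff_odd] at h
    obtain ⟨k, hk⟩ := h
    rw [gket_eq_ket]
    congr 1
    · funext i
      congr 1
      -- The default value `0` of `getD` plays the part of the inserted index `0`.
      simp only [List.getD_eq_getElem?_getD, List.getElem?_append]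
      split_ifs with hi
      · rfl
      · rw [List.getElem?_eq_none (by omega : l.length ≤ i)]
        rcases h : i - l.length with _ | n <;> simp
    · simp; omega

end Kets

/-! ### Two-point functions and the Pfaffian formula for sequences. -/

section TwoPoint

variable {R : Type*} [CommRing R]

theorem field_field_vac_eq_zero {x y : LaurentSeries R} {k l : ℤ} (hx : OrderGE x k)
    (hy : OrderGE y l) (h : 0 < l ∨ 0 < k + l) : field R x (field R y (vac R)) = 0 := by
  rcases h with h | h
  · rw [field_eq_zero hy vac_mem_fil h, map_zero]
  · exact field_eq_zero hx (field_mem_fil hy vac_mem_fil) (by omega)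

variable [Algebra ℚ R]

theorem field_twistVec_eq_sum₁ (β : R) (i m : ℕ) (a : ℤ) {N : ℕ} {d : ℤ} {v : Fock R}
    (hv : v ∈ fil R d) (hN : a + d ≤ N) :
    field R (twistVec β (i + m) a) v = ∑ k ∈ Finset.range (N + 1),
      (β ^ k * ((Ring.choose (-(m : ℤ)) k : ℤ) : R)) • field R (twistVec β i (a - k)) v := by
  obtain ⟨r, hr, h⟩ := twistVec_add β i m N a
  rw [h, map_add, LinearMap.add_apply, field_eq_zero hr hv (by omega), add_zero, map_sum,
    LinearMap.sum_apply]
  simp only [map_smul, LinearMap.smul_apply]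

/-- The inner vector has degree at most `b` and the outer one at most `a + b`, whence the two bounds
on `N`. -/
theorem field_field_twistVec_eq_sum (β : R) (i j m n : ℕ) (a b : ℤ) {N : ℕ}
    (hb : b ≤ N) (hab : a + b ≤ N) :
    field R (twistVec β (i + m) a) (field R (twistVec β (j + n) b) (vac R)) =
      ∑ k ∈ Finset.range (N + 1), ∑ l ∈ Finset.range (N + 1),
        (β ^ (k + l) * ((Ring.choose (-(m : ℤ)) k * Ring.choose (-(n : ℤ)) l : ℤ) : R)) •
          field R (twistVec β i (a - k)) (field R (twistVec β j (b - l)) (vac R)) := by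
  rw [field_twistVec_eq_sum₁ β i m a (N := N) (d := b)
    (by simpa using field_mem_fil (orderGE_twistVec β (j + n) b) vac_mem_fil) hab]
  refine Finset.sum_congr rfl fun k _ => ?_
  rw [field_twistVec_eq_sum₁ β j n b (N := N) (d := 0) vac_mem_fil (by omega), map_sum, Finset.smul_sum]
  refine Finset.sum_congr rfl fun l _ => ?_
  rw [map_smul, smul_smul]
  congr 1
  push_cast
  ring

theorem oSeq_pair (β : R) (p : ℕ → R) (a b : ℤ) : oSeq β p [a, b] = (1 / 4 : ℚ) •
    covac β p (field R (twistVec β 1 a) (field R (twistVec β 2 b) (vac R))) := by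
  rw [oSeq_eq]
  norm_num [ket]

theorem oSeq_singleton (β : R) (p : ℕ → R) (a : ℤ) : oSeq β p [a] = (1 / 2 : ℚ) •
    covac β p (field R (twistVec β 1 a) (field R (twistVec β 2 0) (vac R))) := by
  rw [oSeq_eq]
  norm_num [ket]

theorem oSeq_pair_eq_zero (β : R) (p : ℕ → R) {a b : ℤ} (h : b < 0 ∨ a + b < 0) :
    oSeq β p [a, b] = 0 := by
  rw [oSeq_pair, field_field_vac_eq_zero (orderGE_twistVec β 1 a) (orderGE_twistVec β 2 b) (by omega),
    map_zero, smul_zero]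

theorem oSeq_singleton_eq_zero (β : R) (p : ℕ → R) {a : ℤ} (h : a < 0) : oSeq β p [a] = 0 := by
  rw [oSeq_singleton, field_field_vac_eq_zero (orderGE_twistVec β 1 a) (orderGE_twistVec β 2 0)
    (by omega), map_zero, smul_zero]

theorem pfaffian_congr {S : Type*} [CommRing S] {s : ℕ} {a b : ℕ → ℕ → S}
    (h : ∀ i j, 1 ≤ i → i < j → j ≤ 2 * s → a i j = b i j) : pfaffian s a = pfaffian s b := by
  classical
  unfold pfaffian
  refine Finset.sum_congr rfl fun σ hσ => ?_
  congr 1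
  refine Finset.prod_congr rfl fun t _ => h _ _ (by omega) ?_ (by omega)
  have := (Finset.mem_filter.1 hσ).2.2 t
  rw [Fin.lt_def] at this
  omega

/-- The Pfaffian formula at the level of two-point functions. -/
theorem oSeq_eq_pfaffian (β : R) (p : ℕ → R) (l : List ℤ) {κ : ℕ → ℕ → R}
    (h₂ : ∀ i j, 1 ≤ i → i < j → j ≤ l.length → κ i j = (1 / 4 : ℚ) •
      covac β p (field R (twistVec β i (l.getD (i - 1) 0))
        (field R (twistVec β j (l.getD (j - 1) 0)) (vac R))))
    (h₁ : ∀ i, 1 ≤ i → i ≤ l.length → κ i (l.length + 1) = (1 / 2 : ℚ) •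
      covac β p (field R (twistVec β i (l.getD (i - 1) 0))
        (field R (twistVec β (l.length + 1) 0) (vac R)))) :
    oSeq β p l = pfaffian ((l.length + 1) / 2) κ := by
  -- The prefactor is spread as `1/2` over each genuine index, and `1` over the inserted one:
  -- entries get `1/4`, or `1/2` in the last column for odd length.
  set s : ℕ → R := fun i => if i < l.length then algebraMap ℚ R (1 / 2) else 1
  have hs : ∏ i ∈ Finset.range (2 * ((l.length + 1) / 2)), s i =
      algebraMap ℚ R ((1 / 2) ^ l.length) := by
    rw [← Finset.prod_subset (Finset.range_subset_range.2 (by omega : l.length ≤ _)),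
      Finset.prod_congr rfl fun i hi => if_pos (Finset.mem_range.1 hi)]
    · rw [Finset.prod_const, Finset.card_range, map_pow]
    · intro i _ hi
      exact if_neg fun h => hi (Finset.mem_range.2 h)
  have key := covac_ket β p ((l.length + 1) / 2)
    (fun i => s i • twistVec β (i + 1) (l.getD i 0))
  rw [ket_smul, hs, map_smul, smul_eq_mul, ← Algebra.smul_def] at key
  rw [oSeq_eq, key]
  refine pfaffian_congr fun i j hi hij hj => ?_
  have hsi : s (i - 1) = algebraMap ℚ R (1 / 2) := if_pos (by omega)
  simp only [map_smul, LinearMap.smul_apply, hsi, Nat.sub_add_cancel hi,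
    Nat.sub_add_cancel (hi.trans hij.le)]
  by_cases hjl : j ≤ l.length
  · have hsj : s (j - 1) = algebraMap ℚ R (1 / 2) := if_pos (by omega)
    rw [h₂ i j hi hij hjl, hsj, smul_smul, ← map_mul, smul_eq_mul, ← Algebra.smul_def]
    norm_num
  · obtain rfl : j = l.length + 1 := by omega
    have hsj : s (l.length + 1 - 1) = 1 := if_neg (by omega)
    rw [h₁ i hi (by omega), hsj, one_smul, Nat.add_sub_cancel, List.getD_eq_default _ _ le_rfl,
      smul_eq_mul, ← Algebra.smul_def]

end TwoPoint

/-! ### Identification of the entries `κ_{i,j}`. -/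

section Kappa

theorem support_kappaTerm₂ (lam : List ℕ) (i j : ℕ) :
    Function.support (kappaTerm₂ lam i j) ⊆
      (Finset.range ((part lam i + part lam j).toNat + 1) ×ˢ
        Finset.range ((part lam i + part lam j).toNat + 1) : Finset (ℕ × ℕ)) := by
  intro kl h
  by_contra hkl
  apply h
  have hi : 0 ≤ part lam i := Int.natCast_nonneg _
  have hj : 0 ≤ part lam j := Int.natCast_nonneg _
  rw [Finset.mem_coe, Finset.mem_product, Finset.mem_range, Finset.mem_range] at hkl
  rw [kappaTerm₂, o, oSeq_pair_eq_zero _ _ (by omega), smul_zero, mul_zero]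

theorem support_kappaTerm₁ (lam : List ℕ) (i : ℕ) :
    Function.support (kappaTerm₁ lam i) ⊆ Finset.range ((part lam i).toNat + 1) := by
  intro k h
  by_contra hk
  apply h
  rw [Finset.mem_coe, Finset.mem_range] at hk
  rw [kappaTerm₁, o, oSeq_singleton_eq_zero _ _ (by omega), smul_zero, mul_zero]

/-- With `i = 1 + m` and `j = 2 + n`, the surplus powers `c^m` and `c^n` over those in `o_{(a,b)}`
produce the binomials of `1 - i` and `2 - j`. -/
theorem kappa_of_ne (lam : List ℕ) {i j : ℕ} (hi : 1 ≤ i) (hj : 2 ≤ j) (h : j ≠ lam.length + 1) :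
    kappa lam i j = (1 / 4 : ℚ) • covac beta psum (field Ser (twistVec beta i (part lam i))
      (field Ser (twistVec beta j (part lam j)) (vac Ser))) := by
  have hpi : 0 ≤ part lam i := Int.natCast_nonneg _
  have hpj : 0 ≤ part lam j := Int.natCast_nonneg _
  obtain ⟨m, rfl⟩ := Nat.exists_eq_add_of_le hi
  obtain ⟨n, rfl⟩ := Nat.exists_eq_add_of_le hj
  rw [kappa, if_neg h, finsum_eq_finsetSum_of_support_subset _ (support_kappaTerm₂ lam _ _),
    Finset.sum_product, field_field_twistVec_eq_sum beta 1 2 m n _ _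
      (N := (part lam (1 + m) + part lam (2 + n)).toNat) (by omega) (by omega), map_sum,
    Finset.smul_sum]
  refine Finset.sum_congr rfl fun k _ => ?_
  rw [map_sum, Finset.smul_sum]
  refine Finset.sum_congr rfl fun l _ => ?_
  rw [kappaTerm₂, o, oSeq_pair, map_smul, smul_comm (1 / 4 : ℚ) (_ : Ser), smul_eq_mul, mul_assoc,
    ← zsmul_eq_mul]
  congr 3 <;> push_cast <;> ring_nf

theorem kappa_last (lam : List ℕ) {i : ℕ} (hi : 1 ≤ i) :
    kappa lam i (lam.length + 1) = (1 / 2 : ℚ) • covac beta psum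
      (field Ser (twistVec beta i (part lam i))
        (field Ser (twistVec beta (lam.length + 1) 0) (vac Ser))) := by
  have hpi : 0 ≤ part lam i := Int.natCast_nonneg _
  obtain ⟨m, rfl⟩ := Nat.exists_eq_add_of_le hi
  rw [kappa, if_pos rfl, finsum_eq_finsetSum_of_support_subset _ (support_kappaTerm₁ lam _),
    -- On the vacuum the power `c^{r+1}` may be replaced by `c^2`, the one present in `o_{(a)}`.
    field_twistVec_zero_vac beta _ 2, field_twistVec_eq_sum₁ beta 1 m _
      (N := (part lam (1 + m)).toNat) (d := 0)
      (by simpa using field_mem_fil (orderGE_twistVec beta 2 0) vac_mem_fil) (by omega), map_sum,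
    Finset.smul_sum]
  refine Finset.sum_congr rfl fun k _ => ?_
  rw [kappaTerm₁, o, oSeq_singleton, map_smul, smul_comm (1 / 2 : ℚ) (_ : Ser), smul_eq_mul, mul_assoc,
    ← zsmul_eq_mul]
  congr 3; push_cast; ring_nf

theorem getD_map_natCast (lam : List ℕ) (i : ℕ) :
    (lam.map fun a : ℕ => (a : ℤ)).getD (i - 1) 0 = part lam i := by
  simpa [part] using List.getD_map (l := lam) (d := 0) (n := i - 1) (fun a : ℕ => (a : ℤ))

end Kappa

end NeutralFermion

end

theorem mainTheorem8 (lam : List ℕ) (hlam : NeutralFermion.IsStrictPartition lam) :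
    (∀ i j : ℕ, 1 ≤ i → i < j → j ≤ lam.length →
      (Function.support (NeutralFermion.kappaTerm₂ lam i j)).Finite) ∧
    (∀ i : ℕ, 1 ≤ i → i ≤ lam.length →
      (Function.support (NeutralFermion.kappaTerm₁ lam i)).Finite) ∧
    NeutralFermion.o (lam.map (fun a : ℕ => (a : ℤ))) =
      NeutralFermion.pfaffian ((lam.length + 1) / 2) (NeutralFermion.kappa lam) := by
  open NeutralFermion in
  refine ⟨fun i j _ _ _ => (Finset.finite_toSet _).subset (support_kappaTerm₂ lam i j),
    fun i _ _ => (Finset.finite_toSet _).subset (support_kappaTerm₁ lam i), ?_⟩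
  have h := oSeq_eq_pfaffian beta psum (lam.map fun a : ℕ => (a : ℤ)) (κ := kappa lam)
  simp only [getD_map_natCast, List.length_map] at h
  exact h (fun i j hi hij hj => kappa_of_ne lam hi (by omega) (by omega))
    fun i hi _ => kappa_last lam hi
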